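/- **Scheme.** Let $S\ge 2$ divide $d\ge 1$, $\alpha=1/S$, $\ell=d-d/S$, $\mathcal S=\{0,\dots,S-1\}$, and $\mathcal I(s)=\{s(d-\ell),\dots,(s+1)(d-\ell)-1\}$ for $s\in\mathcal S$. For $x\in\{0,1\}^d$ let $|\mu(x)\rangle=d^{-1/2}\sum_{j}(-1)^{x_j}|j\rangle\in\mathbb C^d$. Messages $x\in\mathcal S^K$ are encoded to codewords $c\in\mathcal S^N$; codewords of distinct messages have Hamming distance at least $2\theta N$ (the code corrects symbol error rate $\theta$). The private key is $k=(k^1,\dots,k^N)$ with $k^i\in\{0,1\}^d$; each copy of the public key is $|P_k\rangle=\bigotimes_i|\mu(k^i)\rangle$. The signature of $x$ consists of the substrings $\kappa_i$ of $k^i$ at the positions outside $\mathcal I(c_i)$. To verify $(x',(\kappa'_i)_i)$, with $c'$ the codeword of $x'$, the verifier measures, for each $i$, the projection of the $i$-th qudit onto the normalized vector $\psi_i\propto\sum_{k:\,k_{[d]\setminus\mathcal I(c'_i)}=\kappa'_i}|\mu(k)\rangle$, and counts the number $z$ of failed projections. The result is 1-ACC if $z\le z_{\rm acc}$, REJ if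 $z\ge z_{\rm rej}$, and 0-ACC in between. **Definitions.** The scheme is *correct with error $\varepsilon$* if for every key and message the verification of the honest signature on $|P_k\rangle$ gives 1-ACC with probability at least $1-\varepsilon$. It is *$\varepsilon$-secure against forgery* if, for uniformly random $k$, every computationally unbounded quantum adversary that holds $|P_k\rangle^{\otimes T}$, chooses (after any measurement) a message $m$, receives its signature, and outputs $(m',r')$ after a further measurement, satisfies $\Pr[m'\ne m\wedge{\sf Verif}(|P_k\rangle,m',r')\ne{\rm REJ}]\le\varepsilon$. **Proposition.** Let $\varphi=T\log_2 d/d\le\alpha$, let $h^{\rm inv}:[0,1]\to[0,\frac12]$ be the inverse of the binary entropy function (in bits), and let $$p_1=(1-\alpha)\Big[\Big(1-\tfrac{\alpha}{1-\alpha}\,2h^{\rm inv}\big(1-\tfrac{\varphi}{\alpha}\big)\Big)^2+\sqrt{\tfrac83}\,\frac{\sqrt{d-\ell}}{\ell}\Big].$$ Assume $1-p_1-\alpha>0$. Let $\varepsilon_{\rm c},\varepsilon_{\rm f}\in(0,1)$, let $\nu>\alpha$ be a constant, and set $$\theta=\tfrac\alpha2(1+\nu),\qquad N\ \ge\ \frac1{\alpha^3}\left(\frac{\sqrt{3\ln\varepsilon_{\rm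 c}^{-1}}+\sqrt{1+4\theta}\sqrt{2\ln\varepsilon_{\rm f}^{-1}}}{(1-p_1-\alpha)/\alpha}\right)^2\quad(N\in\mathbb N),$$ $$z_{\rm acc}=N\alpha+\sqrt{N\alpha}\sqrt{3\ln\varepsilon_{\rm c}^{-1}},\qquad z_{\rm rej}=E-\sqrt{E}\sqrt{2\ln\varepsilon_{\rm f}^{-1}},\quad E=(1-2\theta)N\alpha+2\theta N(1-p_1).$$ Then $\alpha N\le z_{\rm acc}<z_{\rm rej}$, the scheme is correct with error $\varepsilon_{\rm c}$, and it is $\varepsilon_{\rm f}$-secure against forgery. -/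

import Mathlib

noncomputable section

open scoped BigOperators

/-! ## Quantum-public-key signature schemes: general notions -/

/-- The three possible results of a verification: `acc1` is 1-ACC, `acc0` is 0-ACC. -/
inductive Verdict where
  | rej
  | acc0
  | acc1
  deriving DecidableEq

/-- A signature scheme with classical private keys and quantum public keys.  The public-key Hilbert
space has orthonormal basis `ι`.  `verif P m r v` is the probability that the verification of the
state `P`, the message `m` and the alleged signature `r` has the result `v`. -/
structure SignatureScheme (ι Key Msg Sig : Type) where
  pub : Key → EuclideanSpace ℂ ι
  sign : Key → Msg → Sig
  verif : EuclideanSpace ℂ ι → Msg → Sig → Verdict → ℝ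

/-- Correctness with error `ε`: for every private key and every message, an honest signature gets
the result 1-ACC with probability at least `1 - ε`. -/
def SignatureScheme.IsCorrect {ι Key Msg Sig : Type} (Q : SignatureScheme ι Key Msg Sig)
    (ε : ℝ) : Prop :=
  ∀ (k : Key) (m : Msg), 1 - ε ≤ Q.verif (Q.pub k) m (Q.sign k m) Verdict.acc1

/-- The state `ψ ⊗ ⋯ ⊗ ψ` (`T` factors), in the product basis. -/
def tensorCopies {ι : Type} (T : ℕ) (ψ : EuclideanSpace ℂ ι) : EuclideanSpace ℂ (Fin T → ι) :=
  WithLp.toLp 2 fun a => ∏ t, ψ (a t)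

/-- A computationally unbounded quantum forger that is given `T` copies of the public key.
It first performs a general measurement on the copies, whose outcome is the message `m` it wants to
see signed; `meas m` is the measurement operator, and it maps the initial state to the
(unnormalized) state that the forger keeps, in an arbitrary Hilbert space `V` (which can hold
ancillas, private randomness and the environment).  Given the signature `r` of `m`, the forger
measures its state with the POVM `povm m r`, whose outcome is the forgery `(m', r')`. -/
structure ForgeryAdversary (ι Msg Sig : Type) [Fintype ι] [Fintype Msg] [Fintype Sig] (T : ℕ)
    (V : Type) [NormedAddCommGroup V] [InnerProductSpace ℂ V] [CompleteSpace V] where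
  meas : Msg → EuclideanSpace ℂ (Fin T → ι) →L[ℂ] V
  meas_complete : ∀ φ, ∑ m, ‖meas m φ‖ ^ 2 = ‖φ‖ ^ 2
  povm : Msg → Sig → Msg × Sig → V →L[ℂ] V
  povm_pos : ∀ m r o, (povm m r o).IsPositive
  povm_sum : ∀ m r, ∑ o, povm m r o = 1

/-- Probability that the forger, for the private key `k`, asks for the signature of `m` and then
outputs the pair `o = (m', r')`. -/
def ForgeryAdversary.outputProb {ι Key Msg Sig : Type} [Fintype ι] [Fintype Msg] [Fintype Sig]
    {T : ℕ} {V : Type} [NormedAddCommGroup V] [InnerProductSpace ℂ V] [CompleteSpace V]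
    (A : ForgeryAdversary ι Msg Sig T V) (Q : SignatureScheme ι Key Msg Sig)
    (k : Key) (m : Msg) (o : Msg × Sig) : ℝ :=
  (inner ℂ (A.meas m (tensorCopies T (Q.pub k)))
    (A.povm m (Q.sign k m) o (A.meas m (tensorCopies T (Q.pub k))))).re

open Classical in
/-- Probability that `m' ≠ m` and the verification of `(m', r')` does not give REJ, for a uniformly
random private key. -/
def ForgeryAdversary.forgeryProb {ι Key Msg Sig : Type} [Fintype ι] [Fintype Key] [Fintype Msg]
    [Fintype Sig] {T : ℕ} {V : Type} [NormedAddCommGroup V] [InnerProductSpace ℂ V]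
    [CompleteSpace V] (A : ForgeryAdversary ι Msg Sig T V)
    (Q : SignatureScheme ι Key Msg Sig) : ℝ :=
  (Fintype.card Key : ℝ)⁻¹ * ∑ k : Key, ∑ m : Msg, ∑ o : Msg × Sig,
    if o.1 ≠ m then
      A.outputProb Q k m o *
        (Q.verif (Q.pub k) o.1 o.2 Verdict.acc0 + Q.verif (Q.pub k) o.1 o.2 Verdict.acc1)
    else 0

/-- `ε`-security against forgery, against forgers that hold `T` copies of the public key. -/
def SignatureScheme.IsForgerySecure {ι Key Msg Sig : Type} [Fintype ι] [Fintype Key] [Fintype Msg]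
    [Fintype Sig] (Q : SignatureScheme ι Key Msg Sig) (T : ℕ) (ε : ℝ) : Prop :=
  ∀ (V : Type) [NormedAddCommGroup V] [InnerProductSpace ℂ V] [CompleteSpace V]
    (A : ForgeryAdversary ι Msg Sig T V), A.forgeryProb Q ≤ ε

/-! ## The fingerprinting scheme for nonbinary symbols -/

/-- The fingerprinting state `d^{-1/2} ∑ⱼ (-1)^{xⱼ} |j⟩`. -/
def fingerprint {d : ℕ} (x : Fin d → Bool) : EuclideanSpace ℂ (Fin d) :=
  WithLp.toLp 2 fun j => (((Real.sqrt d)⁻¹ : ℝ) : ℂ) * (if x j then -1 else 1)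

/-- The set `I(s) = {s(d-ℓ), …, (s+1)(d-ℓ)-1}` of positions that are not revealed when the symbol
`s` is signed, where `d - ℓ = d/S`. -/
def hiddenSet (d S : ℕ) (s : Fin S) : Finset (Fin d) :=
  Finset.univ.filter fun j => (s : ℕ) * (d / S) ≤ (j : ℕ) ∧ (j : ℕ) < ((s : ℕ) + 1) * (d / S)

/-- The `j`-th element, in increasing order, of the complement of `I(s)`; here `ℓ = d - d/S`. -/
def revealedPos (d S : ℕ) (s : Fin S) (j : Fin (d - d / S)) : Fin d :=
  if (j : ℕ) < (s : ℕ) * (d / S) then ⟨j, j.isLt.trans_le (Nat.sub_le _ _)⟩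
  else ⟨(j : ℕ) + d / S, Nat.add_lt_of_lt_sub j.isLt⟩

theorem revealedPos_val (d S : ℕ) (s : Fin S) (j : Fin (d - d / S)) :
    (revealedPos d S s j : ℕ)
      = if (j : ℕ) < (s : ℕ) * (d / S) then (j : ℕ) else (j : ℕ) + d / S := by
  unfold revealedPos
  split_ifs <;> rfl

theorem revealedPos_strictMono (d S : ℕ) (s : Fin S) : StrictMono (revealedPos d S s) := by
  intro i j hij
  have hij' : (i : ℕ) < (j : ℕ) := hij
  have hij2 : (i : ℕ) < (j : ℕ) + d / S := hij'.trans_le (Nat.le_add_right _ _)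
  rw [Fin.lt_def, revealedPos_val, revealedPos_val]
  split_ifs <;> omega

theorem range_revealedPos (d S : ℕ) (s : Fin S) :
    Set.range (revealedPos d S s) = {j | j ∉ hiddenSet d S s} := by
  have hmul : ((s : ℕ) + 1) * (d / S) = (s : ℕ) * (d / S) + d / S := by ring
  have hle : (s : ℕ) * (d / S) + d / S ≤ d := by
    rw [← hmul]
    exact (Nat.mul_le_mul_right _ s.isLt).trans (Nat.mul_div_le d S)
  ext p
  have hp := p.isLt
  simp only [Set.mem_range, Set.mem_ofPred_eq, hiddenSet, Finset.mem_filter, Finset.mem_univ,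
    true_and, hmul, Fin.ext_iff, revealedPos_val]
  constructor
  · rintro ⟨j, hj⟩
    split_ifs at hj <;> omega
  · intro h
    by_cases hlt : (p : ℕ) < (s : ℕ) * (d / S)
    · have h0 : (p : ℕ) < d - d / S := by
        generalize d / S = n at *
        omega
      exact ⟨⟨p, h0⟩, if_pos hlt⟩
    · have h0 : (p : ℕ) - d / S < d - d / S ∧ ¬ ((p : ℕ) - d / S < (s : ℕ) * (d / S)) ∧
          (p : ℕ) - d / S + d / S = p := by
        generalize d / S = n at *
        generalize (s : ℕ) * n = q at *
        omega
      exact ⟨⟨(p : ℕ) - d / S, h0.1⟩, (if_neg h0.2.1).trans h0.2.2⟩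

/-- The revealed substring of `k` when the symbol `s` is signed. -/
def revealedSubstring {d S : ℕ} (k : Fin d → Bool) (s : Fin S) : Fin (d - d / S) → Bool :=
  fun j => k (revealedPos d S s j)

/-- The normalized vector `ψ` proportional to the sum of all fingerprinting states that are
consistent with the revealed substring `κ` for the symbol `s`. -/
def testVector {d S : ℕ} (s : Fin S) (κ : Fin (d - d / S) → Bool) : EuclideanSpace ℂ (Fin d) :=
  let v : EuclideanSpace ℂ (Fin d) :=
    ∑ k ∈ Finset.univ.filter (fun k : Fin d → Bool => revealedSubstring k s = κ), fingerprint k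
  (((‖v‖)⁻¹ : ℝ) : ℂ) • v

/-- The projector `|ψ⟩⟨ψ|` (outcome '1'), as a matrix. -/
def testProjector {d S : ℕ} (s : Fin S) (κ : Fin (d - d / S) → Bool) :
    Matrix (Fin d) (Fin d) ℂ :=
  Matrix.of fun a a' => testVector s κ a * star (testVector s κ a')

/-- The joint projector on the `N` qudits for the outcome pattern `b`, where `b i = true` means
that the `i`-th qudit gives the outcome '0' (an error). -/
def patternProjector {d S N : ℕ} (c : Fin N → Fin S) (κ : Fin N → Fin (d - d / S) → Bool)
    (b : Fin N → Bool) : Matrix (Fin N → Fin d) (Fin N → Fin d) ℂ :=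
  Matrix.of fun a a' => ∏ i,
    (if b i then 1 - testProjector (c i) (κ i) else testProjector (c i) (κ i)) (a i) (a' i)

/-- Born probability of the outcome pattern `b` on the `N`-qudit state `P`. -/
def patternProb {d S N : ℕ} (c : Fin N → Fin S) (κ : Fin N → Fin (d - d / S) → Bool)
    (P : EuclideanSpace ℂ (Fin N → Fin d)) (b : Fin N → Bool) : ℝ :=
  (∑ a, ∑ a', star (P a) * patternProjector c κ b a a' * P a').re

/-- The verification result for an error tally `z`. -/
def verdictOf (zacc zrej : ℝ) (z : ℕ) : Verdict :=
  if (z : ℝ) ≤ zacc then Verdict.acc1 else if zrej ≤ (z : ℝ) then Verdict.rej else Verdict.acc0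

/-- The signature scheme: messages in `S^K`, encoded by `enc` to codewords in `S^N`; private key
`(kⁱ)` with `kⁱ ∈ {0,1}^d`; public key `|μ(k¹)⟩ ⊗ ⋯ ⊗ |μ(k^N)⟩`; thresholds `zacc`, `zrej`. -/
def fingerprintScheme {K N : ℕ} (d S : ℕ) (enc : (Fin K → Fin S) → (Fin N → Fin S))
    (zacc zrej : ℝ) :
    SignatureScheme (Fin N → Fin d) (Fin N → Fin d → Bool) (Fin K → Fin S)
      (Fin N → Fin (d - d / S) → Bool) where
  pub k := WithLp.toLp 2 fun a => ∏ i, fingerprint (k i) (a i)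
  sign k x := fun i => revealedSubstring (k i) (enc x i)
  verif P x r v := ∑ b ∈ Finset.univ.filter (fun b : Fin N → Bool =>
      verdictOf zacc zrej (Finset.univ.filter (fun i => b i = true)).card = v),
    patternProb (enc x) r P b

/-! ## The parameter settings -/

/-- Binary entropy, in bits. -/
def binEntropyBits (p : ℝ) : ℝ := Real.binEntropy p / Real.log 2

/-- Inverse of the binary entropy function on `[0, 1/2]`. -/
def binEntropyInv (y : ℝ) : ℝ := sInf {p : ℝ | 0 ≤ p ∧ p ≤ 1 / 2 ∧ y ≤ binEntropyBits p}

/-- `φ = T log₂ d / d`. -/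
def phiParam (d T : ℕ) : ℝ := T * Real.logb 2 d / d

/-- The bound `p₁`; here `ℓ = (1-α)d` and `d - ℓ = αd`. -/
def p1Param (α : ℝ) (d T : ℕ) : ℝ :=
  (1 - α) * ((1 - α / (1 - α) * (2 * binEntropyInv (1 - phiParam d T / α))) ^ 2
    + Real.sqrt (8 / 3) * (Real.sqrt (α * d) / ((1 - α) * d)))

/-- The code error rate `θ`. -/
def thetaParam (α ν : ℝ) : ℝ := α / 2 * (1 + ν)

/-- The value prescribed for the codeword length `N`. -/
def lengthParam (α ν : ℝ) (d T : ℕ) (εc εf : ℝ) : ℝ :=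
  1 / α ^ 3 * ((Real.sqrt (3 * Real.log εc⁻¹)
      + Real.sqrt (1 + 4 * thetaParam α ν) * Real.sqrt (2 * Real.log εf⁻¹))
    / ((1 - p1Param α d T - α) / α)) ^ 2

/-- The acceptance threshold. -/
def zAccParam (α : ℝ) (N : ℕ) (εc : ℝ) : ℝ :=
  N * α + Real.sqrt (N * α) * Real.sqrt (3 * Real.log εc⁻¹)

/-- The rejection threshold. -/
def zRejParam (α ν : ℝ) (d T N : ℕ) (εf : ℝ) : ℝ :=
  (1 - 2 * thetaParam α ν) * N * α + 2 * thetaParam α ν * N * (1 - p1Param α d T)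
    - Real.sqrt ((1 - 2 * thetaParam α ν) * N * α + 2 * thetaParam α ν * N * (1 - p1Param α d T))
      * Real.sqrt (2 * Real.log εf⁻¹)

end

/-!
Fix every symbol of the private key except the `i`-th, and let `x` be that symbol. Since each copy
of the public key contributes one coordinate of `x`, the amplitude with which the forger produces
a given forgery has degree at most `T` in the bits of `x` hidden by the signature, and is
arbitrary in the revealed ones. The vector that the verifier projects onto has signed entries on
the positions revealed by the forgery; if the forgery changes the `i`-th codeword symbol, all
hidden bits enter its overlap with the fingerprint of `x`, which is a linear form in the signs
`(-1) ^ x j`. On functions of degree at most `T` the square of the hidden part of this form is at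
most of order `T` times the number of hidden bits, by induction on these bits, so that the test is
passed with probability at most `p₁`. At an unchanged symbol the form has `ℓ` terms, and the
probability is at most `1 - α`. As these bounds hold conditionally on the other symbols, the
moment generating function of the number of failures is dominated by that of independent trials,
and exponential Markov bounds give both tail estimates.
-/

theorem monotoneOn_log_sub_log_div :
    MonotoneOn (fun u : ℝ => (Real.log (1 + u) - Real.log (1 - u)) / u) (Set.Ioo 0 1) := by
  have hasSum_div {u : ℝ} (hu : u ∈ Set.Ioo (0 : ℝ) 1) :
      HasSum (fun k : ℕ => 2 * (1 / (2 * k + 1)) * u ^ (2 * k))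
        ((Real.log (1 + u) - Real.log (1 - u)) / u) := by
    have habs : |u| < 1 := abs_lt.mpr ⟨by linarith [hu.1], hu.2⟩
    refine ((Real.hasSum_log_sub_log_of_abs_lt_one habs).div_const u).congr_fun ?_
    intro k
    rw [pow_succ, ← mul_assoc, mul_div_cancel_right₀ _ hu.1.ne']
  intro u hu v hv huv
  refine hasSum_le (fun k => ?_) (hasSum_div hu) (hasSum_div hv)
  have hu0 : 0 ≤ u := hu.1.le
  gcongr

theorem sqrt_mem_Ioo_zero_one {t : ℝ} (ht : t ∈ Set.Ioo (0 : ℝ) 1) : √t ∈ Set.Ioo (0 : ℝ) 1 :=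
  ⟨Real.sqrt_pos.mpr ht.1, (Real.sqrt_lt' one_pos).mpr (by simpa using ht.2)⟩

theorem hasDerivAt_binEntropy_half_sub_sqrt {t : ℝ} (ht : t ∈ Set.Ioo (0 : ℝ) 1) :
    HasDerivAt (fun t => Real.binEntropy ((1 - √t) / 2))
      (-((Real.log (1 + √t) - Real.log (1 - √t)) / √t / 4)) t := by
  obtain ⟨hs0, hs1⟩ := sqrt_mem_Ioo_zero_one ht
  have hinner := ((Real.hasDerivAt_sqrt ht.1.ne').const_sub 1).div_const 2
  have houter := Real.hasDerivAt_binEntropy (p := (1 - √t) / 2) (by linarith) (by linarith)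
  have hlog1 : Real.log (1 - (1 - √t) / 2) = Real.log (1 + √t) - Real.log 2 := by
    rw [← Real.log_div (by linarith) two_ne_zero]; ring_nf
  have hlog2 : Real.log ((1 - √t) / 2) = Real.log (1 - √t) - Real.log 2 :=
    Real.log_div (by linarith) two_ne_zero
  refine (houter.comp t hinner).congr_deriv ?_
  rw [hlog1, hlog2]
  field_simp
  ring

theorem concaveOn_binEntropy_half_sub_sqrt :
    ConcaveOn ℝ (Set.Icc 0 1) fun t => Real.binEntropy ((1 - √t) / 2) := by
  have hderiv := @hasDerivAt_binEntropy_half_sub_sqrt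
  refine AntitoneOn.concaveOn_of_deriv (convex_Icc 0 1)
    (Real.binEntropy_continuous.comp (by fun_prop)).continuousOn ?_ ?_ <;> rw [interior_Icc]
  · exact fun t ht => (hderiv ht).differentiableAt.differentiableWithinAt
  · intro t ht u hu htu
    rw [(hderiv ht).deriv, (hderiv hu).deriv]
    have := monotoneOn_log_sub_log_div (sqrt_mem_Ioo_zero_one ht) (sqrt_mem_Ioo_zero_one hu)
      (Real.sqrt_le_sqrt htu)
    linarith

theorem one_sub_mul_log_two_le_binEntropy {t : ℝ} (ht : t ∈ Set.Icc (0 : ℝ) 1) :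
    (1 - t) * Real.log 2 ≤ Real.binEntropy ((1 - √t) / 2) := by
  have h := concaveOn_binEntropy_half_sub_sqrt.2 (x := 0) (y := 1) (by simp) (by simp)
    (sub_nonneg.mpr ht.2) ht.1 (sub_add_cancel 1 t)
  simpa using h

theorem binEntropyInv_le {y : ℝ} (hy : y ∈ Set.Icc (0 : ℝ) 1) :
    binEntropyInv (1 - y) ≤ (1 - √y) / 2 := by
  have hs : √y ≤ 1 := Real.sqrt_le_one.mpr hy.2
  refine csInf_le ⟨0, fun p hp => hp.1⟩ ⟨by linarith, by linarith [Real.sqrt_nonneg y], ?_⟩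
  rw [binEntropyBits, le_div_iff₀ (Real.log_pos one_lt_two)]
  exact one_sub_mul_log_two_le_binEntropy hy

section BooleanCube

/-- The sign `(-1)^b`. -/
noncomputable def boolSign (b : Bool) : ℝ := if b then -1 else 1

theorem boolSign_not (b : Bool) : boolSign (!b) = -boolSign b := by
  cases b <;> simp [boolSign]

theorem abs_boolSign (b : Bool) : |boolSign b| = 1 := by
  cases b <;> simp [boolSign]

theorem boolSign_sq (b : Bool) : boolSign b ^ 2 = 1 := by
  rw [← sq_abs, abs_boolSign, one_pow]

variable {ι : Type*}

/-- The linear form `∑_{j ∈ H} τ_j (-1)^{x_j}` on the cube `ι → Bool`. -/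
noncomputable def signSum (τ : ι → ℝ) (H : Finset ι) (x : ι → Bool) : ℝ :=
  ∑ j ∈ H, τ j * boolSign (x j)

theorem abs_signSum_le (τ : ι → ℝ) (H : Finset ι) (x : ι → Bool) :
    |signSum τ H x| ≤ ∑ j ∈ H, |τ j| := by
  refine (Finset.abs_sum_le_sum_abs _ _).trans_eq (Finset.sum_congr rfl fun j _ => ?_)
  rw [abs_mul, abs_boolSign, mul_one]

theorem signSum_sq_le (τ : ι → ℝ) (H : Finset ι) (x : ι → Bool) :
    signSum τ H x ^ 2 ≤ (∑ j ∈ H, |τ j|) ^ 2 :=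
  sq_le_sq.mpr ((abs_signSum_le τ H x).trans (le_abs_self _))

variable [DecidableEq ι]

/-- The point of the cube `ι → Bool` that differs from `x` in the coordinate `j` only. -/
def flipAt (j : ι) (x : ι → Bool) : ι → Bool := Function.update x j (!x j)

theorem flipAt_self (j : ι) (x : ι → Bool) : flipAt j x j = !x j := by simp [flipAt]

theorem flipAt_of_ne {i j : ι} (h : i ≠ j) (x : ι → Bool) : flipAt j x i = x i := by
  simp [flipAt, h]

theorem flipAt_involutive (j : ι) : Function.Involutive (flipAt j) := by
  intro x
  simp [flipAt]

theorem sum_eq_half_sum_add_flipAt [Fintype ι] (j : ι) (F : (ι → Bool) → ℝ) :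
    ∑ x, F x = ∑ x, (F x + F (flipAt j x)) / 2 := by
  rw [← Finset.sum_div, Finset.sum_add_distrib, (flipAt_involutive j).bijective.sum_comp F]
  ring

theorem signSum_flipAt {j : ι} {H : Finset ι} (hj : j ∉ H) (τ : ι → ℝ) (x : ι → Bool) :
    signSum τ H (flipAt j x) = signSum τ H x :=
  Finset.sum_congr rfl fun i hi => by rw [flipAt_of_ne (ne_of_mem_of_not_mem hi hj)]

theorem signSum_insert {j : ι} {H : Finset ι} (hj : j ∉ H) (τ : ι → ℝ) (x : ι → Bool) :
    signSum τ (insert j H) x = τ j * boolSign (x j) + signSum τ H x :=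
  Finset.sum_insert hj

theorem signSum_insert_flipAt {j : ι} {H : Finset ι} (hj : j ∉ H) (τ : ι → ℝ) (x : ι → Bool) :
    signSum τ (insert j H) (flipAt j x) = -(τ j * boolSign (x j)) + signSum τ H x := by
  rw [signSum_insert hj, signSum_flipAt hj, flipAt_self, boolSign_not, mul_neg]

theorem sum_mul_signSum_add_sq_of_flipAt_invariant [Fintype ι] (τ : ι → ℝ) {H : Finset ι}
    {w v : (ι → Bool) → ℝ} (hw : ∀ j ∈ H, ∀ x, w (flipAt j x) = w x)
    (hv : ∀ j ∈ H, ∀ x, v (flipAt j x) = v x) :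
    ∑ x, w x * (signSum τ H x + v x) ^ 2
      = (∑ j ∈ H, τ j ^ 2) * ∑ x, w x + ∑ x, w x * v x ^ 2 := by
  induction H using Finset.induction_on with
  | empty => simp [signSum]
  | insert j H hj ih =>
    rw [Finset.forall_mem_insert] at hw hv
    have hpair (x : ι → Bool) :
        (w x * (signSum τ (insert j H) x + v x) ^ 2
          + w (flipAt j x) * (signSum τ (insert j H) (flipAt j x) + v (flipAt j x)) ^ 2) / 2
        = τ j ^ 2 * w x + w x * (signSum τ H x + v x) ^ 2 := by
      rw [hw.1, hv.1, signSum_insert hj, signSum_insert_flipAt hj]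
      linear_combination w x * τ j ^ 2 * boolSign_sq (x j)
    rw [sum_eq_half_sum_add_flipAt j, Finset.sum_congr rfl fun x _ => hpair x,
      Finset.sum_add_distrib, ih hw.2 hv.2, ← Finset.mul_sum, Finset.sum_insert hj]
    ring

theorem dependsOn_comp_flipAt {β : Type*} {f : (ι → Bool) → β} {A : Set ι} (hf : DependsOn f A)
    (j : ι) : DependsOn (f ∘ flipAt j) A := by
  intro x y hxy
  refine hf fun i hi => ?_
  rcases eq_or_ne i j with rfl | hij
  · rw [flipAt_self, flipAt_self, hxy i hi]
  · rw [flipAt_of_ne hij, flipAt_of_ne hij, hxy i hi]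

theorem comp_flipAt_eq_of_dependsOn {β : Type*} {f : (ι → Bool) → β} {A : Set ι}
    (hf : DependsOn f A) {j : ι} (hj : j ∉ A) : f ∘ flipAt j = f :=
  funext fun x => hf fun _ hi => flipAt_of_ne (ne_of_mem_of_not_mem hi hj) x

variable {V : Type*} [NormedAddCommGroup V] [InnerProductSpace ℝ V]

/-- The part of `f` that is even under the flip of the coordinate `j`. -/
noncomputable def evenPart (j : ι) : ((ι → Bool) → V) →ₗ[ℝ] (ι → Bool) → V :=
  (1 / 2 : ℝ) • (LinearMap.id + LinearMap.funLeft ℝ V (flipAt j))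

/-- The part of `f` that is odd under the flip of the coordinate `j`. -/
noncomputable def oddPart (j : ι) : ((ι → Bool) → V) →ₗ[ℝ] (ι → Bool) → V :=
  (1 / 2 : ℝ) • (LinearMap.id - LinearMap.funLeft ℝ V (flipAt j))

theorem evenPart_add_oddPart (j : ι) (f : (ι → Bool) → V) (x : ι → Bool) :
    evenPart j f x + oddPart j f x = f x := by
  change (1 / 2 : ℝ) • (f x + f (flipAt j x)) + (1 / 2 : ℝ) • (f x - f (flipAt j x)) = f x
  module

theorem evenPart_sub_oddPart (j : ι) (f : (ι → Bool) → V) (x : ι → Bool) :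
    evenPart j f x - oddPart j f x = f (flipAt j x) := by
  change (1 / 2 : ℝ) • (f x + f (flipAt j x)) - (1 / 2 : ℝ) • (f x - f (flipAt j x)) = _
  module

theorem sum_norm_sq_evenPart_add_oddPart [Fintype ι] (j : ι) (f : (ι → Bool) → V) :
    ∑ x, ‖evenPart j f x‖ ^ 2 + ∑ x, ‖oddPart j f x‖ ^ 2 = ∑ x, ‖f x‖ ^ 2 := by
  rw [sum_eq_half_sum_add_flipAt j fun x => ‖f x‖ ^ 2, ← Finset.sum_add_distrib]
  refine Finset.sum_congr rfl fun x _ => ?_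
  rw [← evenPart_sub_oddPart j f x, ← evenPart_add_oddPart j f x]
  linear_combination -parallelogram_law_with_norm ℝ (evenPart j f x) (oddPart j f x) / 2

variable (V) in
/-- The functions on the cube whose degree in the variables in `H` is at most `T`: sums of functions
that depend on at most `T` coordinates in `H`, and on any coordinates outside `H`. -/
def degreeLE (H : Finset ι) (T : ℕ) : Submodule ℝ ((ι → Bool) → V) :=
  Submodule.span ℝ {f | ∃ A : Finset ι, (A ∩ H).card ≤ T ∧ DependsOn f A}

theorem mem_degreeLE_of_dependsOn {A H : Finset ι} {T : ℕ} {f : (ι → Bool) → V}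
    (hA : (A ∩ H).card ≤ T) (hf : DependsOn f A) : f ∈ degreeLE V H T :=
  Submodule.subset_span ⟨A, hA, hf⟩

theorem degreeLE_anti {H H' : Finset ι} (h : H ⊆ H') (T : ℕ) :
    degreeLE V H' T ≤ degreeLE V H T :=
  Submodule.span_mono fun _ ⟨A, hA, hf⟩ =>
    ⟨A, (Finset.card_le_card (Finset.inter_subset_inter_left h)).trans hA, hf⟩

theorem apply_flipAt_of_mem_degreeLE_zero {H : Finset ι} {f : (ι → Bool) → V}
    (hf : f ∈ degreeLE V H 0) {j : ι} (hj : j ∈ H) (x : ι → Bool) : f (flipAt j x) = f x := by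
  suffices f ∈ LinearMap.eqLocus (LinearMap.funLeft ℝ V (flipAt j)) LinearMap.id from
    congrFun this x
  refine Submodule.span_le.mpr ?_ hf
  rintro f ⟨A, hA, hfA⟩
  refine comp_flipAt_eq_of_dependsOn hfA fun hjA => Finset.notMem_empty j ?_
  rw [← Finset.card_eq_zero.mp (Nat.le_zero.mp hA)]
  exact Finset.mem_inter.mpr ⟨hjA, hj⟩

theorem evenPart_mem_degreeLE {H : Finset ι} {T : ℕ} {f : (ι → Bool) → V}
    (hf : f ∈ degreeLE V H T) (j : ι) : evenPart j f ∈ degreeLE V H T := by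
  refine (Submodule.span_le (p := (degreeLE V H T).comap (evenPart j))).mpr ?_ hf
  rintro f ⟨A, hA, hfA⟩
  exact Submodule.smul_mem _ _ (add_mem (mem_degreeLE_of_dependsOn hA hfA)
    (mem_degreeLE_of_dependsOn hA (dependsOn_comp_flipAt hfA j)))

theorem oddPart_mem_degreeLE {H : Finset ι} {T : ℕ} {f : (ι → Bool) → V} {j : ι} (hj : j ∉ H)
    (hf : f ∈ degreeLE V (insert j H) (T + 1)) : oddPart j f ∈ degreeLE V H T := by
  refine (Submodule.span_le (p := (degreeLE V H T).comap (oddPart j))).mpr ?_ hf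
  rintro f ⟨A, hA, hfA⟩
  change (1 / 2 : ℝ) • (f - f ∘ flipAt j) ∈ degreeLE V H T
  by_cases hjA : j ∈ A
  · have hA' : (A ∩ H).card ≤ T := by
      rw [Finset.inter_insert_of_mem hjA, Finset.card_insert_of_notMem (by simp [hj])] at hA
      exact Nat.le_of_succ_le_succ hA
    exact Submodule.smul_mem _ _ (sub_mem (mem_degreeLE_of_dependsOn hA' hfA)
      (mem_degreeLE_of_dependsOn hA' (dependsOn_comp_flipAt hfA j)))
  · rw [comp_flipAt_eq_of_dependsOn hfA (Finset.mem_coe.not.mpr hjA), sub_self, smul_zero]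
    exact zero_mem _

theorem norm_add_sq_mul_add_norm_sub_sq_mul_le (a b : V) (t y : ℝ) {c : ℝ} (hc : 0 < c) :
    (‖a + b‖ ^ 2 * (t + y) ^ 2 + ‖a - b‖ ^ 2 * (-t + y) ^ 2) / 2
      ≤ ‖a‖ ^ 2 * (y ^ 2 + (1 + 2 * c) * t ^ 2)
        + ‖b‖ ^ 2 * ((1 + 2 / c) * y ^ 2 + t ^ 2) := by
  have hcross : 4 * (t * y * inner ℝ a b)
      ≤ 2 * c * (‖a‖ ^ 2 * t ^ 2) + 2 / c * (‖b‖ ^ 2 * y ^ 2) := by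
    have hsq : 0 ≤ 2 / c * ‖(c * t) • a - y • b‖ ^ 2 := by positivity
    rw [norm_sub_sq_real, norm_smul, norm_smul, inner_smul_left, inner_smul_right,
      mul_pow, mul_pow, Real.norm_eq_abs, Real.norm_eq_abs, sq_abs, sq_abs, conj_trivial] at hsq
    refine sub_nonneg.mp (hsq.trans_eq ?_)
    field_simp
    ring
  rw [norm_add_sq_real, norm_sub_sq_real]
  linarith

theorem sum_norm_sq_mul_signSum_insert_sq_le [Fintype ι] {j : ι} {H : Finset ι} (hj : j ∉ H)
    (τ : ι → ℝ) (f : (ι → Bool) → V) {c : ℝ} (hc : 0 < c) :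
    ∑ x, ‖f x‖ ^ 2 * signSum τ (insert j H) x ^ 2
      ≤ ∑ x, ‖evenPart j f x‖ ^ 2 * signSum τ H x ^ 2
        + (1 + 2 * c) * τ j ^ 2 * ∑ x, ‖evenPart j f x‖ ^ 2
        + (1 + 2 / c) * ∑ x, ‖oddPart j f x‖ ^ 2 * signSum τ H x ^ 2
        + τ j ^ 2 * ∑ x, ‖oddPart j f x‖ ^ 2 := by
  rw [sum_eq_half_sum_add_flipAt j]
  simp only [Finset.mul_sum, ← Finset.sum_add_distrib]
  refine Finset.sum_le_sum fun x _ => ?_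
  have hsq : (τ j * boolSign (x j)) ^ 2 = τ j ^ 2 := by rw [mul_pow, boolSign_sq, mul_one]
  rw [signSum_insert hj, signSum_insert_flipAt hj, ← evenPart_sub_oddPart j f x,
    ← evenPart_add_oddPart j f x, ← hsq]
  linarith [norm_add_sq_mul_add_norm_sub_sq_mul_le (evenPart j f x) (oddPart j f x)
    (τ j * boolSign (x j)) (signSum τ H x) hc]

-- The constant `4 * T + 1` absorbs the cross term of the even and the odd part, weighted by
-- `2 * T`; the odd part has lost one degree.
theorem sum_norm_sq_mul_signSum_sq_le [Fintype ι] (τ : ι → ℝ) (H : Finset ι) {T : ℕ}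
    {f : (ι → Bool) → V} (hf : f ∈ degreeLE V H T) :
    ∑ x, ‖f x‖ ^ 2 * signSum τ H x ^ 2
      ≤ (4 * T + 1) * (∑ j ∈ H, τ j ^ 2) * ∑ x, ‖f x‖ ^ 2 := by
  induction H using Finset.induction_on generalizing T f with
  | empty => simp [signSum]
  | insert j H hj ih =>
    obtain _ | T := T
    · have hinv := sum_mul_signSum_add_sq_of_flipAt_invariant τ (w := fun x => ‖f x‖ ^ 2) (v := 0)
        (fun i hi x => by rw [apply_flipAt_of_mem_degreeLE_zero hf hi]) fun _ _ _ => rfl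
      simpa using hinv.le
    · have heven := ih (evenPart_mem_degreeLE (degreeLE_anti (Finset.subset_insert j H) _ hf) j)
      have hodd := ih (oddPart_mem_degreeLE hj hf)
      have hstep := sum_norm_sq_mul_signSum_insert_sq_le hj τ f (c := 2 * (T + 1)) (by positivity)
      have hQ : 0 ≤ ∑ i ∈ H, τ i ^ 2 := Finset.sum_nonneg fun _ _ => sq_nonneg _
      rw [← sum_norm_sq_evenPart_add_oddPart j f, Finset.sum_insert hj]
      have hB : 0 ≤ ∑ x, ‖oddPart j f x‖ ^ 2 := Finset.sum_nonneg fun _ _ => sq_nonneg _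
      push_cast at heven ⊢
      have hodd' := mul_le_mul_of_nonneg_left hodd
        (by positivity : (0 : ℝ) ≤ 1 + 2 / (2 * (T + 1)))
      have hconst : (1 + 2 / (2 * (T + 1))) * (4 * T + 1 : ℝ) ≤ 4 * (T + 1) + 1 := by
        rw [one_add_div (by positivity), div_mul_eq_mul_div, div_le_iff₀ (by positivity)]
        nlinarith
      nlinarith [mul_le_mul_of_nonneg_right hconst (mul_nonneg hQ hB),
        mul_nonneg (mul_nonneg (Nat.cast_nonneg (α := ℝ) T) (sq_nonneg (τ j))) hB,
        mul_nonneg (sq_nonneg (τ j)) hB]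

theorem signSum_add_signSum_compl [Fintype ι] (τ : ι → ℝ) (H : Finset ι) (x : ι → Bool) :
    signSum τ H x + signSum τ Hᶜ x = signSum τ Finset.univ x :=
  Finset.sum_add_sum_compl H _

theorem sum_mul_add_sq_le {κ : Type*} [Fintype κ] {w u v : κ → ℝ} {q r : ℝ} (hw : ∀ x, 0 ≤ w x)
    (hq : 0 ≤ q) (hr : 0 ≤ r) (hu : ∑ x, w x * u x ^ 2 ≤ q ^ 2 * ∑ x, w x)
    (hv : ∀ x, |v x| ≤ r) :
    ∑ x, w x * (u x + v x) ^ 2 ≤ (r + q) ^ 2 * ∑ x, w x := by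
  have hW : 0 ≤ ∑ x, w x := Finset.sum_nonneg fun x _ => hw x
  have hcs : ∑ x, w x * |u x| ≤ q * ∑ x, w x := by
    refine le_of_sq_le_sq ?_ (by positivity)
    calc (∑ x, w x * |u x|) ^ 2 ≤ (∑ x, w x) * ∑ x, w x * u x ^ 2 :=
          Finset.sum_sq_le_sum_mul_sum_of_sq_le_mul _ (fun x _ => hw x)
            (fun x _ => mul_nonneg (hw x) (sq_nonneg _)) fun x _ => by
              rw [mul_pow, sq_abs, sq (w x), mul_assoc]
      _ ≤ (∑ x, w x) * (q ^ 2 * ∑ x, w x) := by gcongr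
      _ = (q * ∑ x, w x) ^ 2 := by ring
  calc ∑ x, w x * (u x + v x) ^ 2
      ≤ ∑ x, w x * (|u x| + r) ^ 2 := by
        refine Finset.sum_le_sum fun x _ => mul_le_mul_of_nonneg_left ?_ (hw x)
        rw [← sq_abs]
        gcongr
        exact (abs_add_le _ _).trans (by gcongr; exact hv x)
    _ = ∑ x, w x * u x ^ 2 + 2 * r * ∑ x, w x * |u x| + r ^ 2 * ∑ x, w x := by
        simp only [Finset.mul_sum, ← Finset.sum_add_distrib]
        refine Finset.sum_congr rfl fun x _ => ?_
        rw [← sq_abs (u x)]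
        ring
    _ ≤ q ^ 2 * ∑ x, w x + 2 * r * (q * ∑ x, w x) + r ^ 2 * ∑ x, w x := by gcongr
    _ = (r + q) ^ 2 * ∑ x, w x := by ring

theorem sum_norm_sq_mul_signSum_univ_sq_le [Fintype ι] (τ : ι → ℝ) {H : Finset ι} {T : ℕ}
    {f : (ι → Bool) → V} (hf : f ∈ degreeLE V H T) :
    ∑ x, ‖f x‖ ^ 2 * signSum τ Finset.univ x ^ 2
      ≤ (∑ j ∈ Hᶜ, |τ j| + √((min (4 * T + 1) H.card : ℕ) * ∑ j ∈ H, τ j ^ 2)) ^ 2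
        * ∑ x, ‖f x‖ ^ 2 := by
  have hQ : 0 ≤ ∑ j ∈ H, τ j ^ 2 := Finset.sum_nonneg fun _ _ => sq_nonneg _
  have hpointwise (x : ι → Bool) : signSum τ H x ^ 2 ≤ H.card * ∑ j ∈ H, τ j ^ 2 := by
    refine (signSum_sq_le τ H x).trans ?_
    simpa only [sq_abs] using sq_sum_le_card_mul_sum_sq (s := H) (f := fun j => |τ j|)
  simp only [← signSum_add_signSum_compl τ H]
  refine sum_mul_add_sq_le (fun x => sq_nonneg _) (Real.sqrt_nonneg _)
    (Finset.sum_nonneg fun _ _ => abs_nonneg _) ?_ fun x => abs_signSum_le τ _ x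
  rw [Real.sq_sqrt (by positivity), Nat.cast_min, Nat.cast_add, Nat.cast_mul, Nat.cast_ofNat,
    Nat.cast_one, min_mul_of_nonneg _ _ hQ,
    min_mul_of_nonneg _ _ (Finset.sum_nonneg fun _ _ => sq_nonneg _), le_min_iff]
  refine ⟨sum_norm_sq_mul_signSum_sq_le τ H hf, ?_⟩
  rw [Finset.mul_sum]
  refine Finset.sum_le_sum fun x _ => ?_
  rw [mul_comm]
  exact mul_le_mul_of_nonneg_right (hpointwise x) (sq_nonneg _)

theorem sum_norm_sq_mul_signSum_univ_sq_le_of_degree_zero [Fintype ι] (τ : ι → ℝ) {H : Finset ι}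
    {f : (ι → Bool) → V} (hf : f ∈ degreeLE V H 0) :
    ∑ x, ‖f x‖ ^ 2 * signSum τ Finset.univ x ^ 2
      ≤ ((∑ j ∈ Hᶜ, |τ j|) ^ 2 + ∑ j ∈ H, τ j ^ 2) * ∑ x, ‖f x‖ ^ 2 := by
  have hcompl : ∑ x, ‖f x‖ ^ 2 * signSum τ Hᶜ x ^ 2
      ≤ (∑ j ∈ Hᶜ, |τ j|) ^ 2 * ∑ x, ‖f x‖ ^ 2 := by
    rw [mul_comm, Finset.sum_mul]
    exact Finset.sum_le_sum fun x _ => mul_le_mul_of_nonneg_left (signSum_sq_le τ _ x) (sq_nonneg _)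
  simp only [← signSum_add_signSum_compl τ H]
  rw [sum_mul_signSum_add_sq_of_flipAt_invariant τ
    (fun j hj x => by rw [apply_flipAt_of_mem_degreeLE_zero hf hj])
    fun j hj => signSum_flipAt (Finset.notMem_compl.mpr hj) τ]
  linarith

end BooleanCube

section Parameters

variable {d n T : ℕ}

theorem p1Param_mul (hn : 0 < n) (hnd : n < d) :
    p1Param (n / d) d T * (d * (d - n))
      = (d - n - 2 * n * binEntropyInv (1 - T * Real.logb 2 d / n)) ^ 2
        + √(8 / 3) * √n * (d - n) := by
  have hd' : (0 : ℝ) < d := Nat.cast_pos.mpr (hn.trans hnd)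
  have hnd' : (0 : ℝ) < d - n := sub_pos.mpr (Nat.cast_lt.mpr hnd)
  have : (0 : ℝ) < n := Nat.cast_pos.mpr hn
  have hone : 1 - (n / d : ℝ) = (d - n) / d := by field_simp
  have hphi : phiParam d T / (n / d) = T * Real.logb 2 d / n := by
    rw [phiParam]; field_simp
  rw [p1Param, hphi, div_mul_cancel₀ _ hd'.ne', hone]
  field_simp

theorem le_p1Param_mul (hn : 0 < n) (h2n : 2 * n ≤ d) (hTL : T * Real.logb 2 d ≤ n) :
    (d - 2 * n + √(n * (T * Real.logb 2 d))) ^ 2 + √(8 / 3) * √n * (d - n)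
      ≤ p1Param (n / d) d T * (d * (d - n)) := by
  have hn' : (0 : ℝ) < n := Nat.cast_pos.mpr hn
  have h2n' : (2 * n : ℝ) ≤ d := mod_cast h2n
  have hL : 0 ≤ Real.logb 2 d := Real.logb_nonneg one_lt_two (mod_cast (by omega : 1 ≤ d))
  rw [p1Param_mul hn (by omega)]
  gcongr
  have hinv := binEntropyInv_le (y := T * Real.logb 2 d / n)
    ⟨by positivity, (div_le_one hn').mpr hTL⟩
  have hsqrt : √(n * (T * Real.logb 2 d)) = n * √(T * Real.logb 2 d / n) := by
    rw [show n * (T * Real.logb 2 d) = n ^ 2 * (T * Real.logb 2 d / n) by field_simp,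
      Real.sqrt_mul (by positivity), Real.sqrt_sq hn'.le]
  rw [hsqrt]
  nlinarith

theorem sixteen_le_of_four_mul_logb_le (hd : 8 ≤ d) (h : 4 * Real.logb 2 d ≤ d) : 16 ≤ d := by
  have hpow : d ^ 4 ≤ 2 ^ d := by
    have hlog : Real.logb 2 (d ^ 4) ≤ d := by rw [Real.logb_pow]; exact_mod_cast h
    rw [Real.logb_le_iff_le_rpow one_lt_two (by positivity), Real.rpow_natCast] at hlog
    exact_mod_cast hlog
  by_contra! hlt
  interval_cases d <;> omega

theorem natCast_le_logb_two {k : ℕ} (h : 2 ^ k ≤ d) : (k : ℝ) ≤ Real.logb 2 d := by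
  rw [Real.le_logb_iff_rpow_le one_lt_two (mod_cast (Nat.two_pow_pos k).trans_le h),
    Real.rpow_natCast]
  exact_mod_cast h

theorem min_four_mul_add_one_le (hn : 0 < n) (h2n : 2 * n ≤ d) (hT : 0 < T)
    (hTL : T * Real.logb 2 d ≤ n) :
    ((min (4 * T + 1) n : ℕ) : ℝ) ≤ T * Real.logb 2 d + 2 := by
  have hT1 : (1 : ℝ) ≤ T := mod_cast hT
  rcases Nat.lt_or_ge n 4 with hn4 | hn4
  · have hL : (1 : ℕ) ≤ Real.logb 2 d := natCast_le_logb_two (by omega)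
    have hmin : ((min (4 * T + 1) n : ℕ) : ℝ) ≤ (3 : ℕ) := mod_cast (by omega)
    push_cast at hL hmin
    push_cast
    nlinarith
  · refine (Nat.cast_le.mpr (min_le_left _ _)).trans ?_
    push_cast
    obtain rfl | hT2 : T = 1 ∨ 2 ≤ T := by omega
    · have hL : (3 : ℕ) ≤ Real.logb 2 d := natCast_le_logb_two (by omega)
      push_cast at hL ⊢
      linarith
    · have hT2' : (2 : ℝ) ≤ T := mod_cast hT2
      have h2n' : (2 * n : ℝ) ≤ d := mod_cast h2n
      have hL0 : (0 : ℕ) ≤ Real.logb 2 d := natCast_le_logb_two (by omega)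
      push_cast at hL0
      have hd : 16 ≤ d := sixteen_le_of_four_mul_logb_le (by omega) (by nlinarith)
      have hL : (4 : ℕ) ≤ Real.logb 2 d := natCast_le_logb_two hd
      push_cast at hL
      nlinarith

theorem sqrt_le_sqrt_add_of_le_add_two_mul {n x y : ℝ} (hn : 0 ≤ n) (hny : n ≤ y)
    (hxy : x ≤ y + 2 * n) : √x ≤ √y + √(8 / 3) * √n / 2 := by
  have h83 : 3 / 2 ≤ √(8 / 3) := Real.le_sqrt_of_sq_le (by norm_num)
  have hny' : n ≤ √n * √y := by
    rw [← Real.sqrt_mul hn]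
    exact Real.le_sqrt_of_sq_le (by nlinarith)
  refine Real.sqrt_le_iff.mpr ⟨by positivity, ?_⟩
  have hcross : 3 / 2 * n ≤ √(8 / 3) * (√n * √y) := by gcongr
  calc x ≤ y + 2 * n := hxy
    _ ≤ y + √(8 / 3) * (√n * √y) + 8 / 3 * n / 4 := by linarith
    _ = √y ^ 2 + √(8 / 3) * (√n * √y) + √(8 / 3) ^ 2 * √n ^ 2 / 4 := by
        rw [Real.sq_sqrt (hn.trans hny), Real.sq_sqrt hn, Real.sq_sqrt (by norm_num)]
    _ = (√y + √(8 / 3) * √n / 2) ^ 2 := by ring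

theorem sub_le_sqrt_mul_sqrt {n m y : ℝ} (hn : 1 ≤ n) (hmn : m ≤ n) (hy : 1 ≤ y)
    (hmy : m ≤ y + 2) : m - y ≤ √(8 / 3) * √n := by
  rw [← Real.sqrt_mul (by norm_num)]
  rcases le_total m y with h | h
  · exact (sub_nonpos.mpr h).trans (Real.sqrt_nonneg _)
  · exact Real.le_sqrt_of_sq_le (by nlinarith)

theorem add_sqrt_mul_sq_le {r n m y : ℝ} (hr : 0 ≤ r) (hn : 1 ≤ n) (hm : 0 ≤ m) (hmn : m ≤ n)
    (hy : 1 ≤ y) (hmy : m ≤ y + 2) :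
    (r + √(m * n)) ^ 2 ≤ (r + √(n * y)) ^ 2 + √(8 / 3) * √n * (r + n) := by
  have hroot : √(m * n) ≤ √(n * y) + √(8 / 3) * √n / 2 :=
    sqrt_le_sqrt_add_of_le_add_two_mul (by positivity) (by nlinarith) (by nlinarith)
  have hdiff : m * n ≤ n * y + √(8 / 3) * √n * n := by
    nlinarith [sub_le_sqrt_mul_sqrt hn hmn hy hmy]
  calc (r + √(m * n)) ^ 2
      = r ^ 2 + 2 * r * √(m * n) + m * n := by rw [add_sq, Real.sq_sqrt (by positivity)]
    _ ≤ r ^ 2 + 2 * r * (√(n * y) + √(8 / 3) * √n / 2) + (n * y + √(8 / 3) * √n * n) := by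
        gcongr
    _ = (r + √(n * y)) ^ 2 + √(8 / 3) * √n * (r + n) := by
        rw [add_sq _ √(n * y), Real.sq_sqrt (by positivity)]
        ring

theorem sq_add_sqrt_min_mul_le (hn : 0 < n) (h2n : 2 * n ≤ d) (hT : 0 < T)
    (hTL : T * Real.logb 2 d ≤ n) :
    (d - 2 * n + √((min (4 * T + 1) n : ℕ) * n)) ^ 2
      ≤ p1Param (n / d) d T * (d * (d - n)) := by
  have hTL1 : 1 ≤ T * Real.logb 2 d := one_le_mul_of_one_le_of_one_le (mod_cast hT)
    (by simpa using natCast_le_logb_two (d := d) (k := 1) (by omega))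
  have h2n' : (0 : ℝ) ≤ d - 2 * n := sub_nonneg.mpr (mod_cast h2n)
  refine (add_sqrt_mul_sq_le h2n' (mod_cast hn) (Nat.cast_nonneg _)
    (mod_cast min_le_right _ _) hTL1 (min_four_mul_add_one_le hn h2n hT hTL)).trans ?_
  refine le_trans (le_of_eq ?_) (le_p1Param_mul hn h2n hTL)
  ring

theorem sq_add_le_p1Param_zero_mul (hn : 0 < n) (h2n : 2 * n ≤ d) :
    (d - 2 * n) ^ 2 + n ≤ p1Param (n / d) d 0 * (d * (d - n)) := by
  refine le_trans ?_ (le_p1Param_mul hn h2n (by simp))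
  have h83 : 1 ≤ √(8 / 3) := Real.one_le_sqrt.mpr (by norm_num)
  have hsqrt : 1 ≤ √(n : ℝ) := Real.one_le_sqrt.mpr (mod_cast hn)
  have h2n' : (2 * n : ℝ) ≤ d := mod_cast h2n
  have hone := one_le_mul_of_one_le_of_one_le h83 hsqrt
  simp only [Nat.cast_zero, zero_mul, mul_zero, Real.sqrt_zero, add_zero]
  nlinarith

theorem one_sub_three_mul_lt_p1Param (hn : 0 < n) (h2n : 2 * n ≤ d)
    (hTL : T * Real.logb 2 d ≤ n) : 1 - 3 * (n / d : ℝ) < p1Param (n / d) d T := by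
  have hn' : (0 : ℝ) < n := Nat.cast_pos.mpr hn
  have h2n' : (2 * n : ℝ) ≤ d := mod_cast h2n
  have hd : (0 : ℝ) < d := by linarith
  have hdn : (0 : ℝ) < d - n := by linarith
  have h := le_p1Param_mul hn h2n hTL
  have hextra : 0 < √(8 / 3) * √n * (d - n : ℝ) := by positivity
  have hsq : (d - 2 * n : ℝ) ^ 2 ≤ (d - 2 * n + √(n * (T * Real.logb 2 d))) ^ 2 := by
    gcongr
    exact le_add_of_nonneg_right (Real.sqrt_nonneg _)
  have heq : (1 - 3 * (n / d : ℝ)) * (d * (d - n)) = (d - 2 * n) ^ 2 - n ^ 2 := by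
    field_simp
    ring
  refine lt_of_mul_lt_mul_right ?_ (mul_pos hd hdn).le
  nlinarith

theorem p1Param_nonneg {α : ℝ} (hα1 : α ≤ 1) : 0 ≤ p1Param α d T := by
  have := sub_nonneg.mpr hα1
  unfold p1Param
  positivity

theorem natCast_div_div_le_one (d S : ℕ) : ((d / S : ℕ) : ℝ) / d ≤ 1 :=
  div_le_one_of_le₀ (Nat.cast_le.mpr (Nat.div_le_self d S)) d.cast_nonneg

end Parameters

section TestVectors

variable {d S : ℕ}

theorem revealedPos_injective (s : Fin S) : Function.Injective (revealedPos d S s) :=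
  (revealedPos_strictMono d S s).injective

theorem revealedPos_notMem_hiddenSet (s : Fin S) (j : Fin (d - d / S)) :
    revealedPos d S s j ∉ hiddenSet d S s :=
  (range_revealedPos d S s).subset ⟨j, rfl⟩

theorem exists_revealedPos_eq {s : Fin S} {a : Fin d} (ha : a ∉ hiddenSet d S s) :
    ∃ j, revealedPos d S s j = a :=
  (range_revealedPos d S s).superset ha

theorem card_hiddenSet (s : Fin S) : (hiddenSet d S s).card = d / S := by
  have himage : Finset.univ.image (revealedPos d S s) = (hiddenSet d S s)ᶜ := by
    rw [← Finset.coe_inj, Finset.coe_image, Finset.coe_univ, Set.image_univ, range_revealedPos]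
    ext a
    simp
  have hcard : d - d / S = d - (hiddenSet d S s).card := by
    simpa [Finset.card_image_of_injective _ (revealedPos_injective s), Finset.card_compl]
      using congrArg Finset.card himage
  have hle : (hiddenSet d S s).card ≤ d := by simpa using Finset.card_le_univ (hiddenSet d S s)
  have hdiv : d / S ≤ d := Nat.div_le_self d S
  omega

theorem disjoint_hiddenSet {s s' : Fin S} (h : s ≠ s') :
    Disjoint (hiddenSet d S s) (hiddenSet d S s') := by
  wlog hlt : s < s' generalizing s s'
  · exact (this h.symm ((not_lt.mp hlt).lt_of_ne h.symm)).symm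
  rw [Finset.disjoint_left]
  intro a ha ha'
  simp only [hiddenSet, Finset.mem_filter] at ha ha'
  have hle : ((s : ℕ) + 1) * (d / S) ≤ s' * (d / S) := Nat.mul_le_mul_right _ hlt
  exact absurd (ha.2.2.trans_le hle) (not_lt.mpr ha'.2.1)

/-- The signs of the bits of the substring `κ` revealed for the symbol `s`, with the value `0` at
the hidden positions: up to normalization, the coordinates of `testVector s κ`. -/
noncomputable def revealedSign (s : Fin S) (κ : Fin (d - d / S) → Bool) : Fin d → ℝ :=
  Function.extend (revealedPos d S s) (fun j => boolSign (κ j)) 0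

theorem revealedSign_revealedPos (s : Fin S) (κ : Fin (d - d / S) → Bool)
    (j : Fin (d - d / S)) : revealedSign s κ (revealedPos d S s j) = boolSign (κ j) :=
  (revealedPos_injective s).extend_apply _ _ _

theorem revealedSign_of_mem_hiddenSet {s : Fin S} (κ : Fin (d - d / S) → Bool) {a : Fin d}
    (ha : a ∈ hiddenSet d S s) : revealedSign s κ a = 0 :=
  Function.extend_apply' _ _ _ fun ⟨j, hj⟩ => revealedPos_notMem_hiddenSet s j (hj ▸ ha)

theorem abs_revealedSign (s : Fin S) (κ : Fin (d - d / S) → Bool) (a : Fin d) :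
    |revealedSign s κ a| = if a ∉ hiddenSet d S s then 1 else 0 := by
  by_cases ha : a ∈ hiddenSet d S s
  · rw [revealedSign_of_mem_hiddenSet κ ha, abs_zero, if_neg (not_not.mpr ha)]
  · obtain ⟨j, rfl⟩ := exists_revealedPos_eq ha
    rw [revealedSign_revealedPos, abs_boolSign, if_pos ha]

theorem sum_abs_revealedSign (s : Fin S) (κ : Fin (d - d / S) → Bool) (A : Finset (Fin d)) :
    ∑ a ∈ A, |revealedSign s κ a| = (A \ hiddenSet d S s).card := by
  simp only [abs_revealedSign, Finset.sum_boole, Finset.filter_notMem_eq_sdiff]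

theorem sum_revealedSign_sq (s : Fin S) (κ : Fin (d - d / S) → Bool) (A : Finset (Fin d)) :
    ∑ a ∈ A, revealedSign s κ a ^ 2 = (A \ hiddenSet d S s).card := by
  rw [← sum_abs_revealedSign s κ]
  refine Finset.sum_congr rfl fun a _ => ?_
  rw [← sq_abs, abs_revealedSign]
  split_ifs <;> norm_num

theorem card_univ_sdiff_hiddenSet (s : Fin S) :
    (Finset.univ \ hiddenSet d S s).card = d - d / S := by
  rw [Finset.card_univ_sdiff, card_hiddenSet, Fintype.card_fin]

theorem fingerprint_apply (x : Fin d → Bool) (a : Fin d) :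
    fingerprint x a = (((√d)⁻¹ * boolSign (x a) : ℝ) : ℂ) := by
  simp only [fingerprint, boolSign]
  split_ifs <;> simp

theorem norm_sq_fingerprint (hd : 0 < d) (x : Fin d → Bool) : ‖fingerprint x‖ ^ 2 = 1 := by
  have hd' : (d : ℝ) ≠ 0 := Nat.cast_ne_zero.mpr hd.ne'
  simp only [EuclideanSpace.norm_sq_eq, fingerprint_apply, Complex.norm_real, Real.norm_eq_abs,
    sq_abs, mul_pow, boolSign_sq, inv_pow, Real.sq_sqrt d.cast_nonneg]
  simp [hd']

theorem sum_consistent_boolSign_of_mem_hiddenSet {s : Fin S} (κ : Fin (d - d / S) → Bool)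
    {a : Fin d} (ha : a ∈ hiddenSet d S s) :
    ∑ k : Fin d → Bool with revealedSubstring k s = κ, boolSign (k a) = 0 := by
  refine Finset.sum_involution (fun k _ => flipAt a k) (fun k _ => ?_) (fun k _ _ h => ?_)
    (fun k hk => ?_) fun k _ => flipAt_involutive a k
  · rw [flipAt_self, boolSign_not, add_neg_cancel]
  · simpa [flipAt_self] using congrFun h a
  · refine Finset.mem_filter.mpr ⟨Finset.mem_univ _, ?_⟩
    rw [← (Finset.mem_filter.mp hk).2]
    exact funext fun j =>
      flipAt_of_ne (ne_of_mem_of_not_mem ha (revealedPos_notMem_hiddenSet s j)).symm k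

theorem sum_consistent_fingerprint_apply (s : Fin S) (κ : Fin (d - d / S) → Bool) (a : Fin d) :
    (∑ k : Fin d → Bool with revealedSubstring k s = κ, fingerprint k) a
      = (((Finset.univ.filter fun k : Fin d → Bool => revealedSubstring k s = κ).card
          * (√d)⁻¹ * revealedSign s κ a : ℝ) : ℂ) := by
  rw [WithLp.ofLp_sum, Finset.sum_apply]
  simp only [fingerprint_apply]
  rw [← Complex.ofReal_sum, ← Finset.mul_sum]
  congr 1
  by_cases ha : a ∈ hiddenSet d S s
  · rw [revealedSign_of_mem_hiddenSet κ ha, sum_consistent_boolSign_of_mem_hiddenSet κ ha,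
      mul_zero, mul_zero]
  · obtain ⟨j, rfl⟩ := exists_revealedPos_eq ha
    rw [revealedSign_revealedPos, Finset.sum_eq_card_nsmul fun k hk =>
      congrArg boolSign (congrFun (Finset.mem_filter.mp hk).2 j), nsmul_eq_mul]
    ring

theorem exists_revealedSubstring_eq (s : Fin S) (κ : Fin (d - d / S) → Bool) :
    ∃ k : Fin d → Bool, revealedSubstring k s = κ :=
  ⟨Function.extend (revealedPos d S s) κ fun _ => false,
    funext fun _ => (revealedPos_injective s).extend_apply _ _ _⟩

theorem testVector_apply (hd : 0 < d) (s : Fin S) (κ : Fin (d - d / S) → Bool) (a : Fin d) :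
    testVector s κ a = (((√((d - d / S : ℕ) : ℝ))⁻¹ * revealedSign s κ a : ℝ) : ℂ) := by
  set c : ℝ := (Finset.univ.filter fun k : Fin d → Bool => revealedSubstring k s = κ).card
    * (√d)⁻¹ with hc
  have hc0 : 0 < c := by
    obtain ⟨k, hk⟩ := exists_revealedSubstring_eq s κ
    have hcard : 0 < (Finset.univ.filter fun k : Fin d → Bool => revealedSubstring k s = κ).card :=
      Finset.card_pos.mpr ⟨k, Finset.mem_filter.mpr ⟨Finset.mem_univ k, hk⟩⟩
    positivity
  have hnorm : ∑ a, ‖((c * revealedSign s κ a : ℝ) : ℂ)‖ ^ 2 = c ^ 2 * ((d - d / S : ℕ) : ℝ) := by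
    simp only [Complex.norm_real, Real.norm_eq_abs, sq_abs, mul_pow]
    rw [← Finset.mul_sum, sum_revealedSign_sq, card_univ_sdiff_hiddenSet]
  simp only [testVector, EuclideanSpace.norm_eq, PiLp.smul_apply, sum_consistent_fingerprint_apply,
    ← hc, hnorm]
  rw [Real.sqrt_mul (sq_nonneg c), Real.sqrt_sq hc0.le, smul_eq_mul, ← Complex.ofReal_mul]
  congr 1
  field_simp

theorem sq_div_mul_self (a b : ℝ) : a ^ 2 / (b * a) = a / b := by
  rcases eq_or_ne a 0 with rfl | ha
  · simp
  · rw [sq, mul_div_mul_right _ _ ha]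

/-- The probability that the projection of the fingerprinting state of `x` onto
`testVector s κ` succeeds. -/
noncomputable def passProb (s : Fin S) (κ : Fin (d - d / S) → Bool) (x : Fin d → Bool) : ℝ :=
  ‖inner ℂ (testVector s κ) (fingerprint x)‖ ^ 2

theorem passProb_eq (hd : 0 < d) (s : Fin S) (κ : Fin (d - d / S) → Bool) (x : Fin d → Bool) :
    passProb s κ x
      = signSum (revealedSign s κ) Finset.univ x ^ 2 / (d * ((d - d / S : ℕ) : ℝ)) := by
  have hinner : inner ℂ (testVector s κ) (fingerprint x)
      = (((√((d - d / S : ℕ) : ℝ))⁻¹ * (√d)⁻¹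
          * signSum (revealedSign s κ) Finset.univ x : ℝ) : ℂ) := by
    simp only [PiLp.inner_apply, testVector_apply hd, fingerprint_apply, RCLike.inner_apply,
      Complex.conj_ofReal, ← Complex.ofReal_mul, ← Complex.ofReal_sum, signSum, Finset.mul_sum]
    congr 1
    exact Finset.sum_congr rfl fun a _ => by ring
  rw [passProb, hinner, Complex.norm_real, Real.norm_eq_abs, sq_abs, mul_pow, mul_pow, inv_pow,
    inv_pow, Real.sq_sqrt (Nat.cast_nonneg _), Real.sq_sqrt (Nat.cast_nonneg _)]
  ring

theorem passProb_le (hd : 0 < d) (s : Fin S) (κ : Fin (d - d / S) → Bool) (x : Fin d → Bool) :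
    passProb s κ x ≤ ((d - d / S : ℕ) : ℝ) / d := by
  have hsq := signSum_sq_le (revealedSign s κ) Finset.univ x
  rw [sum_abs_revealedSign, card_univ_sdiff_hiddenSet] at hsq
  rw [passProb_eq hd]
  exact (div_le_div_of_nonneg_right hsq (by positivity)).trans_eq (sq_div_mul_self _ _)

theorem passProb_mem_Icc (hd : 0 < d) (s : Fin S) (κ : Fin (d - d / S) → Bool)
    (x : Fin d → Bool) : passProb s κ x ∈ Set.Icc 0 1 :=
  ⟨sq_nonneg _, (passProb_le hd s κ x).trans
    (div_le_one_of_le₀ (Nat.cast_le.mpr (Nat.sub_le _ _)) (Nat.cast_nonneg _))⟩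

theorem signSum_revealedSign_revealedSubstring (s : Fin S) (x : Fin d → Bool) :
    signSum (revealedSign s (revealedSubstring x s)) Finset.univ x = ((d - d / S : ℕ) : ℝ) := by
  rw [← card_univ_sdiff_hiddenSet s, ← sum_revealedSign_sq s (revealedSubstring x s), signSum]
  refine Finset.sum_congr rfl fun a _ => ?_
  by_cases ha : a ∈ hiddenSet d S s
  · simp [revealedSign_of_mem_hiddenSet _ ha]
  · obtain ⟨j, rfl⟩ := exists_revealedPos_eq ha
    rw [revealedSign_revealedPos, revealedSubstring, sq]

theorem passProb_revealedSubstring (hd : 0 < d) (s : Fin S) (x : Fin d → Bool) :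
    passProb s (revealedSubstring x s) x = ((d - d / S : ℕ) : ℝ) / d := by
  rw [passProb_eq hd, signSum_revealedSign_revealedSubstring, sq_div_mul_self]

end TestVectors

section FailurePatterns

variable {I : Type*} [Fintype I]

/-- The probability of the pattern `b` of failures (`b i = true`) in independent tests, where the
`i`-th test is passed with probability `w i`. -/
noncomputable def patternWeight (w : I → ℝ) (b : I → Bool) : ℝ :=
  ∏ i, if b i then 1 - w i else w i

theorem patternWeight_nonneg {w : I → ℝ} (hw : ∀ i, w i ∈ Set.Icc 0 1) (b : I → Bool) :
    0 ≤ patternWeight w b :=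
  Finset.prod_nonneg fun i _ => by split_ifs <;> linarith [(hw i).1, (hw i).2]

theorem sum_patternWeight_mul_prod [DecidableEq I] (w : I → ℝ) (y : ℝ) :
    ∑ b : I → Bool, patternWeight w b * ∏ i, (if b i then y else 1)
      = ∏ i, (w i + y * (1 - w i)) := by
  simp only [patternWeight, ← Finset.prod_mul_distrib]
  rw [← Fintype.prod_sum fun i (b : Bool) =>
    (if b then 1 - w i else w i) * (if b then y else 1)]
  refine Finset.prod_congr rfl fun i _ => ?_
  simp only [Fintype.sum_bool, if_true, Bool.false_eq_true, if_false]
  ring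

theorem sum_patternWeight [DecidableEq I] (w : I → ℝ) :
    ∑ b : I → Bool, patternWeight w b = 1 := by
  simpa using sum_patternWeight_mul_prod w 1

theorem sum_filter_patternWeight_le [DecidableEq I] {w : I → ℝ} (hw : ∀ i, w i ∈ Set.Icc 0 1)
    {t z : ℝ} {p : (I → Bool) → Prop} [DecidablePred p]
    (hp : ∀ b, p b → 0 ≤ t * ((Finset.univ.filter fun i => b i = true).card - z)) :
    ∑ b with p b, patternWeight w b
      ≤ Real.exp (-(t * z)) * ∏ i, (w i + Real.exp t * (1 - w i)) := by
  have htilt (b : I → Bool) :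
      Real.exp (-(t * z)) * (patternWeight w b * ∏ i, (if b i then Real.exp t else 1))
        = patternWeight w b
          * Real.exp (t * ((Finset.univ.filter fun i => b i = true).card - z)) := by
    rw [← Finset.prod_filter, Finset.prod_const, ← Real.exp_nat_mul, mul_left_comm, ← Real.exp_add]
    ring_nf
  rw [← sum_patternWeight_mul_prod, Finset.mul_sum]
  simp only [htilt]
  calc ∑ b with p b, patternWeight w b
      ≤ ∑ b with p b, patternWeight w b
          * Real.exp (t * ((Finset.univ.filter fun i => b i = true).card - z)) :=
        Finset.sum_le_sum fun b hb => le_mul_of_one_le_right (patternWeight_nonneg hw b)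
          (Real.one_le_exp (hp b (Finset.mem_filter.mp hb).2))
    _ ≤ _ := Finset.sum_le_sum_of_subset_of_nonneg (Finset.filter_subset _ _) fun b _ _ =>
        mul_nonneg (patternWeight_nonneg hw b) (Real.exp_pos _).le

theorem prod_add_mul_one_sub_le_exp {w : I → ℝ} (hw : ∀ i, w i ∈ Set.Icc 0 1) {u : ℝ}
    (hu : 0 ≤ u) : ∏ i, (w i + u * (1 - w i)) ≤ Real.exp ((u - 1) * ∑ i, (1 - w i)) := by
  rw [Finset.mul_sum, Real.exp_sum]
  refine Finset.prod_le_prod (fun i _ => ?_) fun i _ => ?_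
  · exact add_nonneg (hw i).1 (mul_nonneg hu (sub_nonneg.mpr (hw i).2))
  · linarith [Real.add_one_le_exp ((u - 1) * (1 - w i))]

theorem add_sq_div_three_le_one_add_mul_log {δ : ℝ} (h0 : 0 ≤ δ) (h1 : δ ≤ 1) :
    δ + δ ^ 2 / 3 ≤ (1 + δ) * Real.log (1 + δ) := by
  have hrational : δ + δ ^ 2 / 3 ≤ (1 + δ) * (2 * δ / (δ + 2)) := by
    rw [mul_div_assoc', le_div_iff₀ (by linarith)]
    nlinarith [mul_nonneg (sq_nonneg δ) (sub_nonneg.mpr h1)]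
  exact hrational.trans
    (mul_le_mul_of_nonneg_left (Real.le_log_one_add_of_nonneg h0) (by linarith))

theorem neg_add_sq_div_two_le_one_sub_mul_log {δ : ℝ} (h0 : 0 ≤ δ) (h1 : δ < 1) :
    -δ + δ ^ 2 / 2 ≤ (1 - δ) * Real.log (1 - δ) := by
  have hpos : 0 < 1 - δ := sub_pos.mpr h1
  have hlog : 0 ≤ Real.log (1 - δ)⁻¹ :=
    Real.log_nonneg ((one_le_inv₀ hpos).mpr (sub_le_self 1 h0))
  have hsinh := Real.self_le_sinh_iff.mpr hlog
  rw [Real.sinh_log (inv_pos.mpr hpos), Real.log_inv, inv_inv] at hsinh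
  have hmul := mul_le_mul_of_nonneg_left hsinh hpos.le
  have heval : (1 - δ) * (((1 - δ)⁻¹ - (1 - δ)) / 2) = δ - δ ^ 2 / 2 := by
    field_simp
    ring
  linarith

theorem upper_tail_exponent_le {M a : ℝ} (hM : 0 < M) (ha : 0 ≤ a) (haM : a ≤ √M) :
    -(Real.log (1 + a / √M) * (M + √M * a)) + a / √M * M ≤ -(a ^ 2 / 3) := by
  have hsqrt : 0 < √M := Real.sqrt_pos.mpr hM
  set δ := a / √M
  have hlog := add_sq_div_three_le_one_add_mul_log (div_nonneg ha hsqrt.le)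
    ((div_le_one hsqrt).mpr haM)
  have haδ : a = δ * √M := (div_mul_cancel₀ a hsqrt.ne').symm
  have hsq : √M ^ 2 = M := Real.sq_sqrt hM.le
  calc -(Real.log (1 + δ) * (M + √M * a)) + δ * M
      = -(M * ((1 + δ) * Real.log (1 + δ))) + δ * M := by
        rw [haδ]
        linear_combination -(Real.log (1 + δ) * δ) * hsq
    _ ≤ -(M * (δ + δ ^ 2 / 3)) + δ * M := by gcongr
    _ = -(a ^ 2 / 3) := by
        rw [haδ, mul_pow, hsq]
        ring

theorem lower_tail_exponent_le {E b : ℝ} (hb : 0 ≤ b) (hbE : b < √E) :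
    -(Real.log (1 - b / √E) * (E - √E * b)) - b / √E * E ≤ -(b ^ 2 / 2) := by
  have hsqrt : 0 < √E := hb.trans_lt hbE
  have hE : 0 < E := Real.sqrt_pos.mp hsqrt
  set δ := b / √E
  have hlog := neg_add_sq_div_two_le_one_sub_mul_log (div_nonneg hb hsqrt.le)
    ((div_lt_one hsqrt).mpr hbE)
  have hbδ : b = δ * √E := (div_mul_cancel₀ b hsqrt.ne').symm
  have hsq : √E ^ 2 = E := Real.sq_sqrt hE.le
  calc -(Real.log (1 - δ) * (E - √E * b)) - δ * E
      = -(E * ((1 - δ) * Real.log (1 - δ))) - δ * E := by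
        rw [hbδ]
        linear_combination Real.log (1 - δ) * δ * hsq
    _ ≤ -(E * (-δ + δ ^ 2 / 2)) - δ * E := by gcongr
    _ = -(b ^ 2 / 2) := by
        rw [hbδ, mul_pow, hsq]
        ring

theorem sum_patternWeight_card_gt_le [DecidableEq I] {w : I → ℝ} (hw : ∀ i, w i ∈ Set.Icc 0 1)
    {M a : ℝ} (hM : 0 < M) (hwM : ∑ i, (1 - w i) ≤ M) (ha : 0 ≤ a) (haM : a ≤ √M) :
    ∑ b : I → Bool with M + √M * a < (Finset.univ.filter fun i => b i = true).card,
      patternWeight w b ≤ Real.exp (-(a ^ 2 / 3)) := by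
  have hδ : 0 ≤ a / √M := by positivity
  have hexp : Real.exp (Real.log (1 + a / √M)) = 1 + a / √M := Real.exp_log (by positivity)
  have hmarkov := sum_filter_patternWeight_le hw (t := Real.log (1 + a / √M)) (z := M + √M * a)
    (p := fun b => M + √M * a < (Finset.univ.filter fun i => b i = true).card) fun b hb =>
      mul_nonneg (Real.log_nonneg (le_add_of_nonneg_right hδ)) (sub_nonneg.mpr hb.le)
  rw [hexp] at hmarkov
  refine hmarkov.trans ?_
  calc Real.exp (-(Real.log (1 + a / √M) * (M + √M * a)))
        * ∏ i, (w i + (1 + a / √M) * (1 - w i))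
      ≤ Real.exp (-(Real.log (1 + a / √M) * (M + √M * a)))
        * Real.exp ((1 + a / √M - 1) * ∑ i, (1 - w i)) := by
        gcongr
        exact prod_add_mul_one_sub_le_exp hw (by positivity)
    _ ≤ Real.exp (-(a ^ 2 / 3)) := by
        rw [← Real.exp_add, Real.exp_le_exp, add_sub_cancel_left]
        exact (add_le_add_right (mul_le_mul_of_nonneg_left hwM hδ) _).trans
          (upper_tail_exponent_le hM ha haM)

theorem exp_neg_log_mul_prod_le {w : I → ℝ} (hw : ∀ i, w i ∈ Set.Icc 0 1) {E b z : ℝ} (hb : 0 ≤ b)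
    (hbE : b < √E) (hE : E ≤ ∑ i, (1 - w i)) (hz : z ≤ E - √E * b) :
    Real.exp (-(Real.log (1 - b / √E) * z)) * ∏ i, (w i + (1 - b / √E) * (1 - w i))
      ≤ Real.exp (-(b ^ 2 / 2)) := by
  have hs : 0 < √E := hb.trans_lt hbE
  have hδ : 0 ≤ b / √E := by positivity
  have hu : 0 ≤ 1 - b / √E := sub_nonneg.mpr ((div_le_one hs).mpr hbE.le)
  have hlog : Real.log (1 - b / √E) ≤ 0 := Real.log_nonpos hu (sub_le_self 1 hδ)
  refine (mul_le_mul_of_nonneg_left (prod_add_mul_one_sub_le_exp hw hu)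
    (Real.exp_pos _).le).trans ?_
  rw [← Real.exp_add, Real.exp_le_exp]
  linarith [lower_tail_exponent_le hb hbE, mul_le_mul_of_nonpos_left hz hlog,
    mul_le_mul_of_nonneg_left hE hδ]

end FailurePatterns

section Verification

variable {K N d S : ℕ}

theorem sum_star_mul_testProjector_mul (s : Fin S) (κ : Fin (d - d / S) → Bool)
    (x : Fin d → Bool) :
    ∑ a, ∑ a', star (fingerprint x a) * testProjector s κ a a' * fingerprint x a'
      = (passProb s κ x : ℂ) := by
  have hprod : ∑ a, ∑ a', star (fingerprint x a) * testProjector s κ a a' * fingerprint x a'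
      = inner ℂ (fingerprint x) (testVector s κ) * inner ℂ (testVector s κ) (fingerprint x) := by
    simp only [PiLp.inner_apply, RCLike.inner_apply, Finset.sum_mul_sum, testProjector,
      Matrix.of_apply, starRingEnd_apply]
    exact Finset.sum_congr rfl fun a _ => Finset.sum_congr rfl fun a' _ => by ring
  rw [hprod, ← inner_conj_symm, Complex.conj_mul', passProb, Complex.ofReal_pow]

theorem sum_star_mul_one_mul (hd : 0 < d) (x : Fin d → Bool) :
    ∑ a, ∑ a', star (fingerprint x a) * (1 : Matrix (Fin d) (Fin d) ℂ) a a' * fingerprint x a'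
      = 1 := by
  have hnorm : inner ℂ (fingerprint x) (fingerprint x) = (1 : ℂ) := by
    rw [inner_self_eq_norm_sq_to_K, ← RCLike.ofReal_pow, norm_sq_fingerprint hd, RCLike.ofReal_one]
  rw [← hnorm]
  simp only [PiLp.inner_apply, RCLike.inner_apply]
  simp [Matrix.one_apply, mul_comm]

/-- The state `|μ(k¹)⟩ ⊗ ⋯ ⊗ |μ(k^N)⟩`, which is the public key of the private key `k`. -/
noncomputable def keyState (k : Fin N → Fin d → Bool) : EuclideanSpace ℂ (Fin N → Fin d) :=
  WithLp.toLp 2 fun a => ∏ i, fingerprint (k i) (a i)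

theorem patternProb_keyState (hd : 0 < d) (k : Fin N → Fin d → Bool) (c : Fin N → Fin S)
    (κ : Fin N → Fin (d - d / S) → Bool) (b : Fin N → Bool) :
    patternProb c κ (keyState k) b
      = patternWeight (fun i => passProb (c i) (κ i) (k i)) b := by
  have hfactor (i : Fin N) : ∑ a, ∑ a', star (fingerprint (k i) a)
      * (if b i then 1 - testProjector (c i) (κ i) else testProjector (c i) (κ i)) a a'
      * fingerprint (k i) a'
      = ((if b i then 1 - passProb (c i) (κ i) (k i) else passProb (c i) (κ i) (k i) : ℝ) : ℂ) := by
    split_ifs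
    · simp only [Matrix.sub_apply, mul_sub, sub_mul, Finset.sum_sub_distrib]
      rw [sum_star_mul_one_mul hd, sum_star_mul_testProjector_mul, Complex.ofReal_sub,
        Complex.ofReal_one]
    · exact sum_star_mul_testProjector_mul _ _ _
  rw [patternProb, patternWeight, ← Complex.ofReal_re (∏ i, _), Complex.ofReal_prod]
  simp only [← hfactor, Fintype.prod_sum, keyState, patternProjector, Matrix.of_apply, star_prod,
    Finset.prod_mul_distrib]

variable (enc : (Fin K → Fin S) → Fin N → Fin S) (zacc zrej : ℝ)

theorem verif_keyState (hd : 0 < d) (k : Fin N → Fin d → Bool) (x : Fin K → Fin S)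
    (r : Fin N → Fin (d - d / S) → Bool) (v : Verdict) :
    (fingerprintScheme d S enc zacc zrej).verif (keyState k) x r v
      = ∑ b : Fin N → Bool with
          verdictOf zacc zrej (Finset.univ.filter fun i => b i = true).card = v,
        patternWeight (fun i => passProb (enc x i) (r i) (k i)) b :=
  Finset.sum_congr rfl fun b _ => patternProb_keyState hd k (enc x) r b

variable {zacc zrej}

theorem isCorrect_fingerprintScheme {a ε : ℝ} (hn : 0 < d / S) (ha : 0 < a)
    (haN : a ≤ √(N * ((d / S : ℕ) / d)))
    (hzacc : N * ((d / S : ℕ) / d) + √(N * ((d / S : ℕ) / d)) * a ≤ zacc)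
    (hε : Real.exp (-(a ^ 2 / 3)) ≤ ε) :
    (fingerprintScheme d S enc zacc zrej).IsCorrect ε := by
  intro k m
  have hd : 0 < d := hn.trans_le (Nat.div_le_self d S)
  set w : Fin N → ℝ := fun i => passProb (enc m i) (revealedSubstring (k i) (enc m i)) (k i)
  have hw (i : Fin N) : w i ∈ Set.Icc 0 1 := passProb_mem_Icc hd _ _ _
  have hfail (i : Fin N) : 1 - w i = (d / S : ℕ) / d := by
    have hd' : (d : ℝ) ≠ 0 := Nat.cast_ne_zero.mpr hd.ne'
    simp only [w, passProb_revealedSubstring hd, Nat.cast_sub (Nat.div_le_self d S)]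
    field_simp
    ring
  have hmean : ∑ i, (1 - w i) = N * ((d / S : ℕ) / d) := by simp [hfail]
  have htail := sum_patternWeight_card_gt_le hw (Real.sqrt_pos.mp (ha.trans_le haN))
    hmean.le ha.le haN
  have hsum := sum_patternWeight w
  rw [← Finset.sum_filter_add_sum_filter_not Finset.univ fun b : Fin N → Bool =>
    verdictOf zacc zrej (Finset.univ.filter fun i => b i = true).card = Verdict.acc1] at hsum
  have hreject : ∑ b : Fin N → Bool with
      ¬ verdictOf zacc zrej (Finset.univ.filter fun i => b i = true).card = Verdict.acc1,
      patternWeight w b ≤ ε := by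
    refine (Finset.sum_le_sum_of_subset_of_nonneg ?_
      fun b _ _ => patternWeight_nonneg hw b).trans (htail.trans hε)
    refine Finset.monotone_filter_right _ fun b _ hb => hzacc.trans_lt (not_le.mp fun hle => hb ?_)
    rw [verdictOf, if_pos hle]
  refine le_of_le_of_eq ?_ (verif_keyState enc zacc zrej hd k m _ _).symm
  exact sub_le_iff_le_add.mpr (hsum.symm.le.trans (add_le_add_right hreject _))

end Verification

section ProductBound

variable {I X : Type*} [Fintype I] [DecidableEq I] [Fintype X]

theorem sum_sum_update (i : I) (F : (I → X) → ℝ) :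
    ∑ h, ∑ x, F (Function.update h i x) = Fintype.card X * ∑ h, F h := by
  have hupdate (y : X) (z : {j // j ≠ i} → X) (x : X) :
      Function.update ((Equiv.funSplitAt i X).symm (y, z)) i x
        = (Equiv.funSplitAt i X).symm (x, z) := by
    funext j
    by_cases hj : j = i
    · subst hj; simp
    · simp [hj]
  rw [← (Equiv.funSplitAt i X).symm.sum_comp, ← (Equiv.funSplitAt i X).symm.sum_comp F,
    Fintype.sum_prod_type, Fintype.sum_prod_type]
  simp only [hupdate]
  rw [Finset.sum_const, Finset.card_univ, nsmul_eq_mul, Finset.sum_comm]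

theorem sum_mul_prod_insert_le [Nonempty X] {G : (I → X) → ℝ} {f : I → X → ℝ} {β : ℝ}
    (hf : ∀ i x, 0 ≤ f i x) {i : I} {s : Finset I} (hi : i ∉ s)
    (h : ∀ k, ∑ x, G (Function.update k i x) * f i x ≤ β * ∑ x, G (Function.update k i x)) :
    ∑ k, G k * ∏ j ∈ insert i s, f j (k j) ≤ β * ∑ k, G k * ∏ j ∈ s, f j (k j) := by
  have hcard : (0 : ℝ) < Fintype.card X := Nat.cast_pos.mpr Fintype.card_pos
  have hrest (k : I → X) (x : X) :
      ∏ j ∈ s, f j (Function.update k i x j) = ∏ j ∈ s, f j (k j) :=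
    Finset.prod_congr rfl fun j hj => by rw [Function.update_of_ne (ne_of_mem_of_not_mem hj hi)]
  refine le_of_mul_le_mul_left ?_ hcard
  rw [mul_left_comm, ← sum_sum_update i, ← sum_sum_update i, Finset.mul_sum]
  refine Finset.sum_le_sum fun k _ => ?_
  simp only [Finset.prod_insert hi, hrest, Function.update_self, ← mul_assoc]
  rw [← Finset.sum_mul, ← Finset.sum_mul, ← mul_assoc]
  exact mul_le_mul_of_nonneg_right (h k) (Finset.prod_nonneg fun j _ => hf j _)

theorem sum_mul_prod_le [Nonempty X] {G : (I → X) → ℝ} {f : I → X → ℝ} {β : I → ℝ}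
    (hf : ∀ i x, 0 ≤ f i x) (hβ : ∀ i, 0 ≤ β i)
    (h : ∀ i k, ∑ x, G (Function.update k i x) * f i x
      ≤ β i * ∑ x, G (Function.update k i x)) :
    ∑ k, G k * ∏ i, f i (k i) ≤ (∏ i, β i) * ∑ k, G k := by
  suffices ∀ s : Finset I, ∑ k, G k * ∏ i ∈ s, f i (k i) ≤ (∏ i ∈ s, β i) * ∑ k, G k from
    this Finset.univ
  intro s
  induction s using Finset.induction_on with
  | empty => simp
  | insert i s hi ih =>
    rw [Finset.prod_insert hi, mul_assoc]
    exact (sum_mul_prod_insert_le hf hi (h i)).trans (mul_le_mul_of_nonneg_left ih (hβ i))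

end ProductBound

section ForgerState

attribute [local instance] InnerProductSpace.complexToReal

variable {d N T : ℕ}

theorem norm_sq_prod {I J : Type*} [Fintype I] [DecidableEq I] [Fintype J]
    (f : I → EuclideanSpace ℂ J) :
    ‖(WithLp.toLp 2 fun a : I → J => ∏ i, f i (a i) : EuclideanSpace ℂ (I → J))‖ ^ 2
      = ∏ i, ‖f i‖ ^ 2 := by
  simp only [EuclideanSpace.norm_sq_eq, norm_prod, ← Finset.prod_pow]
  rw [Fintype.prod_sum]

theorem norm_sq_tensorCopies_keyState (hd : 0 < d) (k : Fin N → Fin d → Bool) :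
    ‖tensorCopies T (keyState k)‖ ^ 2 = 1 := by
  have hkey : ‖keyState k‖ ^ 2 = 1 :=
    (norm_sq_prod fun i => fingerprint (k i)).trans (by simp [norm_sq_fingerprint hd])
  exact (norm_sq_prod fun _ : Fin T => keyState k).trans (by simp [hkey])

theorem dependsOn_tensorCopies_keyState_update (k : Fin N → Fin d → Bool) (i : Fin N)
    (a : Fin T → Fin N → Fin d) :
    DependsOn (fun x => tensorCopies T (keyState (Function.update k i x)) a)
      (Finset.univ.image fun t => a t i : Finset (Fin d)) := by
  intro x y hxy
  change ∏ t, ∏ j, fingerprint (Function.update k i x j) (a t j)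
    = ∏ t, ∏ j, fingerprint (Function.update k i y j) (a t j)
  refine Finset.prod_congr rfl fun t _ => Finset.prod_congr rfl fun j _ => ?_
  rcases eq_or_ne j i with rfl | hj
  · rw [Function.update_self, Function.update_self, fingerprint_apply, fingerprint_apply,
      hxy _ (Finset.mem_coe.mpr (Finset.mem_image_of_mem _ (Finset.mem_univ t)))]
  · rw [Function.update_of_ne hj, Function.update_of_ne hj]

variable {V : Type*} [NormedAddCommGroup V] [InnerProductSpace ℂ V]

theorem apply_tensorCopies_keyState_update_mem_degreeLE {H : Finset (Fin d)}
    {L : (Fin d → Bool) → EuclideanSpace ℂ (Fin T → Fin N → Fin d) →L[ℂ] V}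
    (hL : DependsOn L (Hᶜ : Finset (Fin d))) (k : Fin N → Fin d → Bool) (i : Fin N) :
    (fun x => L x (tensorCopies T (keyState (Function.update k i x)))) ∈ degreeLE V H T := by
  set e := EuclideanSpace.basisFun (Fin T → Fin N → Fin d) ℂ
  have hexpand : (fun x => L x (tensorCopies T (keyState (Function.update k i x))))
      = ∑ a, fun x => tensorCopies T (keyState (Function.update k i x)) a • L x (e a) := by
    funext x
    conv_lhs => rw [← e.sum_repr (tensorCopies T (keyState (Function.update k i x)))]
    simp [e]
  rw [hexpand]
  refine Submodule.sum_mem _ fun a _ =>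
    mem_degreeLE_of_dependsOn (A := Hᶜ ∪ Finset.univ.image fun t => a t i) ?_ fun x y hxy => ?_
  · rw [Finset.union_inter_distrib_right, Finset.inter_comm Hᶜ, Finset.inter_compl,
      Finset.empty_union]
    exact (Finset.card_le_card Finset.inter_subset_left).trans
      (Finset.card_image_le.trans_eq (Finset.card_fin T))
  · rw [Finset.coe_union] at hxy
    exact congrArg₂ (fun z l => z • l (e a))
      (dependsOn_tensorCopies_keyState_update k i a fun j hj => hxy j (Or.inr hj))
      (hL fun j hj => hxy j (Or.inl hj))

theorem two_mul_div_le_of_ne {S : ℕ} {s s' : Fin S} (h : s ≠ s') : 2 * (d / S) ≤ d := by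
  have hcard := Finset.card_le_univ (hiddenSet d S s ∪ hiddenSet d S s')
  rw [Finset.card_union_of_disjoint (disjoint_hiddenSet h), card_hiddenSet, card_hiddenSet,
    Fintype.card_fin] at hcard
  omega

theorem card_compl_hiddenSet_sdiff {S : ℕ} {s s' : Fin S} (h : s ≠ s') :
    (((hiddenSet d S s)ᶜ \ hiddenSet d S s').card : ℝ) = d - 2 * (d / S : ℕ) := by
  rw [sdiff_eq, Finset.inf_eq_inter, ← Finset.compl_union, Finset.card_compl,
    Finset.card_union_of_disjoint (disjoint_hiddenSet h), card_hiddenSet, card_hiddenSet,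
    Fintype.card_fin, ← two_mul, Nat.cast_sub (two_mul_div_le_of_ne h), Nat.cast_mul,
    Nat.cast_ofNat]

theorem card_hiddenSet_sdiff {S : ℕ} {s s' : Fin S} (h : s ≠ s') :
    (hiddenSet d S s \ hiddenSet d S s').card = d / S := by
  rw [Finset.sdiff_eq_self_of_disjoint (disjoint_hiddenSet h), card_hiddenSet]

theorem sum_norm_sq_mul_passProb_le {S : ℕ} (hn : 0 < d / S)
    (hTL : T * Real.logb 2 d ≤ (d / S : ℕ)) {s s' : Fin S} (h : s ≠ s')
    (κ : Fin (d - d / S) → Bool) {g : (Fin d → Bool) → V}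
    (hg : g ∈ degreeLE V (hiddenSet d S s) T) :
    ∑ x, ‖g x‖ ^ 2 * passProb s' κ x ≤ p1Param ((d / S : ℕ) / d) d T * ∑ x, ‖g x‖ ^ 2 := by
  have hd : 0 < d := hn.trans_le (Nat.div_le_self d S)
  have hle := two_mul_div_le_of_ne (d := d) h
  have hlt : ((d / S : ℕ) : ℝ) < d := Nat.cast_lt.mpr (by omega)
  have hdn : (0 : ℝ) < d * (d - (d / S : ℕ)) := by
    have := sub_pos.mpr hlt
    positivity
  have hsignSum : ∑ x, ‖g x‖ ^ 2 * signSum (revealedSign s' κ) Finset.univ x ^ 2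
      ≤ p1Param ((d / S : ℕ) / d) d T * (d * (d - (d / S : ℕ))) * ∑ x, ‖g x‖ ^ 2 := by
    rcases Nat.eq_zero_or_pos T with rfl | hT
    · refine (sum_norm_sq_mul_signSum_univ_sq_le_of_degree_zero (revealedSign s' κ) hg).trans ?_
      gcongr
      rw [sum_abs_revealedSign, sum_revealedSign_sq, card_compl_hiddenSet_sdiff h,
        card_hiddenSet_sdiff h]
      exact sq_add_le_p1Param_zero_mul hn hle
    · refine (sum_norm_sq_mul_signSum_univ_sq_le (revealedSign s' κ) hg).trans ?_
      gcongr
      rw [sum_abs_revealedSign, sum_revealedSign_sq, card_compl_hiddenSet_sdiff h,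
        card_hiddenSet_sdiff h, card_hiddenSet]
      exact sq_add_sqrt_min_mul_le hn hle hT hTL
  simp only [passProb_eq hd, ← mul_div_assoc, Nat.cast_sub (Nat.div_le_self d S)]
  rw [← Finset.sum_div, div_le_iff₀ hdn]
  linarith

end ForgerState

section Forger

attribute [local instance] InnerProductSpace.complexToReal

variable {V : Type} [NormedAddCommGroup V] [InnerProductSpace ℂ V] [CompleteSpace V]

theorem exists_re_inner_eq_norm_sq {E : V →L[ℂ] V} (hE : E.IsPositive) :
    ∃ B : V →L[ℂ] V, ∀ x, (inner ℂ x (E x)).re = ‖B x‖ ^ 2 := by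
  obtain ⟨B, hB⟩ := CStarAlgebra.nonneg_iff_eq_star_mul_self.mp
    ((ContinuousLinearMap.nonneg_iff_isPositive E).mpr hE)
  refine ⟨B, fun x => ?_⟩
  rw [hB, mul_apply_eq_comp, ContinuousLinearMap.star_eq_adjoint,
    ContinuousLinearMap.adjoint_inner_right]
  exact inner_self_eq_norm_sq (𝕜 := ℂ) (B x)

theorem ForgeryAdversary.outputProb_nonneg {ι Key Msg Sig : Type} [Fintype ι] [Fintype Msg]
    [Fintype Sig] {T : ℕ} (A : ForgeryAdversary ι Msg Sig T V)
    (Q : SignatureScheme ι Key Msg Sig) (k : Key) (m : Msg) (o : Msg × Sig) :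
    0 ≤ A.outputProb Q k m o :=
  (A.povm_pos m (Q.sign k m) o).re_inner_nonneg_right _

theorem ForgeryAdversary.sum_outputProb {ι Key Msg Sig : Type} [Fintype ι] [Fintype Msg]
    [Fintype Sig] {T : ℕ} (A : ForgeryAdversary ι Msg Sig T V)
    (Q : SignatureScheme ι Key Msg Sig) (k : Key) :
    ∑ m, ∑ o, A.outputProb Q k m o = ‖tensorCopies T (Q.pub k)‖ ^ 2 := by
  rw [← A.meas_complete]
  refine Finset.sum_congr rfl fun m _ => ?_
  simp only [ForgeryAdversary.outputProb]
  rw [← Complex.re_sum, ← inner_sum, ← sum_apply, A.povm_sum, one_apply_eq_self]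
  exact inner_self_eq_norm_sq (𝕜 := ℂ) _

variable {K N d S T : ℕ} (enc : (Fin K → Fin S) → Fin N → Fin S) (zacc zrej : ℝ)

theorem dependsOn_sign_update (k : Fin N → Fin d → Bool) (m : Fin K → Fin S) (i : Fin N) :
    DependsOn (fun x => (fingerprintScheme d S enc zacc zrej).sign (Function.update k i x) m)
      ((hiddenSet d S (enc m i))ᶜ : Finset (Fin d)) := by
  intro x y hxy
  funext j
  change revealedSubstring (Function.update k i x j) (enc m j)
    = revealedSubstring (Function.update k i y j) (enc m j)
  rcases eq_or_ne j i with rfl | hj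
  · rw [Function.update_self, Function.update_self]
    exact funext fun p => hxy _ (Finset.mem_coe.mpr
      (Finset.mem_compl.mpr (revealedPos_notMem_hiddenSet _ p)))
  · rw [Function.update_of_ne hj, Function.update_of_ne hj]

variable
  (A : ForgeryAdversary (Fin N → Fin d) (Fin K → Fin S) (Fin N → Fin (d - d / S) → Bool) T V)
  (m : Fin K → Fin S) (o : (Fin K → Fin S) × (Fin N → Fin (d - d / S) → Bool))

theorem exists_mem_degreeLE_outputProb_eq (k : Fin N → Fin d → Bool) (i : Fin N) :
    ∃ g ∈ degreeLE V (hiddenSet d S (enc m i)) T, ∀ x,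
      A.outputProb (fingerprintScheme d S enc zacc zrej) (Function.update k i x) m o
        = ‖g x‖ ^ 2 := by
  choose B hB using fun r => exists_re_inner_eq_norm_sq (A.povm_pos m r o)
  exact ⟨_, apply_tensorCopies_keyState_update_mem_degreeLE
    (L := fun x => (B ((fingerprintScheme d S enc zacc zrej).sign (Function.update k i x) m)).comp
      (A.meas m))
    (fun x y hxy => congrArg (fun r => (B r).comp (A.meas m))
      (dependsOn_sign_update enc zacc zrej k m i hxy)) k i,
    fun x => hB _ _⟩

/-- An upper bound for the probability that a forged symbol passes its test, given everything but
that symbol of the private key: `p` where the codewords `c` and `c'` of the signed and of the forged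
message differ, `1 - α` where they agree. -/
noncomputable def passBound {I X : Type*} [DecidableEq X] (α p : ℝ) (c c' : I → X) (i : I) : ℝ :=
  if c i ≠ c' i then p else 1 - α

theorem passBound_nonneg {I X : Type*} [DecidableEq X] {α p : ℝ} (hα : α ≤ 1) (hp : 0 ≤ p)
    (c c' : I → X) (i : I) : 0 ≤ passBound α p c c' i := by
  rw [passBound]
  split_ifs
  exacts [hp, sub_nonneg.mpr hα]

theorem passBound_le_one {I X : Type*} [DecidableEq X] {α p : ℝ} (hα : 0 ≤ α) (hp : p ≤ 1)
    (c c' : I → X) (i : I) : passBound α p c c' i ≤ 1 := by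
  rw [passBound]
  split_ifs
  exacts [hp, sub_le_self 1 hα]

theorem sum_one_sub_passBound {I X : Type*} [Fintype I] [DecidableEq X] (α p : ℝ) (c c' : I → X) :
    ∑ i, (1 - passBound α p c c' i)
      = Fintype.card I * α + hammingDist c c' * (1 - p - α) := by
  have hterm (i : I) : 1 - passBound α p c c' i = α + if c i ≠ c' i then 1 - p - α else 0 := by
    rw [passBound]
    split_ifs <;> ring
  simp only [hterm, Finset.sum_add_distrib, ← Finset.sum_filter, Finset.sum_const, nsmul_eq_mul,
    Finset.card_univ, hammingDist]

theorem sum_outputProb_update_mul_passProb_le (hn : 0 < d / S)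
    (hTL : T * Real.logb 2 d ≤ (d / S : ℕ)) (k : Fin N → Fin d → Bool) (i : Fin N) :
    ∑ x, A.outputProb (fingerprintScheme d S enc zacc zrej) (Function.update k i x) m o
        * passProb (enc o.1 i) (o.2 i) x
      ≤ passBound ((d / S : ℕ) / d) (p1Param ((d / S : ℕ) / d) d T) (enc m) (enc o.1) i
        * ∑ x, A.outputProb (fingerprintScheme d S enc zacc zrej) (Function.update k i x) m o := by
  have hd : 0 < d := hn.trans_le (Nat.div_le_self d S)
  rw [passBound]
  split_ifs with hne
  · obtain ⟨g, hg, houtput⟩ := exists_mem_degreeLE_outputProb_eq enc zacc zrej A m o k i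
    simp only [houtput]
    exact sum_norm_sq_mul_passProb_le hn hTL hne _ hg
  · have hmax : ((d - d / S : ℕ) : ℝ) / d = 1 - (d / S : ℕ) / d := by
      rw [Nat.cast_sub (Nat.div_le_self d S), sub_div, div_self (Nat.cast_ne_zero.mpr hd.ne')]
    rw [mul_comm, Finset.sum_mul, ← hmax]
    exact Finset.sum_le_sum fun x _ =>
      mul_le_mul_of_nonneg_left (passProb_le hd _ _ x) (A.outputProb_nonneg _ _ m o)

theorem sum_outputProb_mul_prod_passProb_le (hn : 0 < d / S)
    (hTL : T * Real.logb 2 d ≤ (d / S : ℕ)) {u : ℝ} (hu : u ∈ Set.Icc 0 1)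
    {β : Fin N → ℝ}
    (hβ : β = passBound ((d / S : ℕ) / d) (p1Param ((d / S : ℕ) / d) d T) (enc m) (enc o.1)) :
    ∑ k, A.outputProb (fingerprintScheme d S enc zacc zrej) k m o
        * ∏ i, (passProb (enc o.1 i) (o.2 i) (k i)
          + u * (1 - passProb (enc o.1 i) (o.2 i) (k i)))
      ≤ (∏ i, (β i + u * (1 - β i)))
        * ∑ k, A.outputProb (fingerprintScheme d S enc zacc zrej) k m o := by
  have hd : 0 < d := hn.trans_le (Nat.div_le_self d S)
  have hα1 := natCast_div_div_le_one d S
  have hβ0 (i : Fin N) : 0 ≤ β i := hβ ▸ passBound_nonneg hα1 (p1Param_nonneg hα1) _ _ i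
  have haffine (p : ℝ) : p + u * (1 - p) = u + (1 - u) * p := by ring
  have hu' : 0 ≤ 1 - u := sub_nonneg.mpr hu.2
  simp only [haffine]
  refine sum_mul_prod_le (f := fun i x => u + (1 - u) * passProb (enc o.1 i) (o.2 i) x)
    (fun i x => add_nonneg hu.1 (mul_nonneg hu' (passProb_mem_Icc hd _ _ _).1))
    (fun i => add_nonneg hu.1 (mul_nonneg hu' (hβ0 i))) fun i k => ?_
  have hpass := sum_outputProb_update_mul_passProb_le enc zacc zrej A m o hn hTL k i
  rw [← hβ] at hpass
  simp only [mul_add, Finset.sum_add_distrib, ← Finset.sum_mul, mul_left_comm _ (1 - u),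
    ← Finset.mul_sum]
  linarith [mul_le_mul_of_nonneg_left hpass hu']

end Forger

section Security

variable {V : Type} [NormedAddCommGroup V] [InnerProductSpace ℂ V] [CompleteSpace V]
  {K N d S T : ℕ} (enc : (Fin K → Fin S) → Fin N → Fin S) {zacc zrej : ℝ}

theorem verif_acc0_add_verif_acc1_le (hd : 0 < d) (hz : zacc < zrej) (k : Fin N → Fin d → Bool)
    (x : Fin K → Fin S) (r : Fin N → Fin (d - d / S) → Bool) {t : ℝ} (ht : t ≤ 0) :
    (fingerprintScheme d S enc zacc zrej).verif (keyState k) x r Verdict.acc0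
        + (fingerprintScheme d S enc zacc zrej).verif (keyState k) x r Verdict.acc1
      ≤ Real.exp (-(t * zrej)) * ∏ i, (passProb (enc x i) (r i) (k i)
        + Real.exp t * (1 - passProb (enc x i) (r i) (k i))) := by
  rw [verif_keyState enc zacc zrej hd, verif_keyState enc zacc zrej hd, ← Finset.sum_union,
    ← Finset.filter_or]
  · refine sum_filter_patternWeight_le (fun i => passProb_mem_Icc hd _ _ _) fun b hb => ?_
    refine mul_nonneg_of_nonpos_of_nonpos ht (sub_nonpos.mpr ?_)
    by_contra! hlt
    rw [verdictOf, if_neg (hz.trans hlt).not_ge, if_pos hlt.le] at hb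
    simp at hb
  · rw [Finset.disjoint_filter]
    intro b _ hacc0 hacc1
    exact absurd (hacc0.symm.trans hacc1) (by decide)

theorem sum_outputProb_mul_verif_le
    (A : ForgeryAdversary (Fin N → Fin d) (Fin K → Fin S) (Fin N → Fin (d - d / S) → Bool) T V)
    (m : Fin K → Fin S) (o : (Fin K → Fin S) × (Fin N → Fin (d - d / S) → Bool))
    (hn : 0 < d / S) (hTL : T * Real.logb 2 d ≤ (d / S : ℕ))
    (hp1 : p1Param ((d / S : ℕ) / d) d T ≤ 1) {E b : ℝ} (hb : 0 ≤ b) (hbE : b < √E)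
    (hz : zacc < zrej) (hzrej : zrej ≤ E - √E * b)
    (hE : E ≤ N * ((d / S : ℕ) / d) + hammingDist (enc m) (enc o.1)
      * (1 - p1Param ((d / S : ℕ) / d) d T - (d / S : ℕ) / d)) :
    ∑ k, A.outputProb (fingerprintScheme d S enc zacc zrej) k m o
        * ((fingerprintScheme d S enc zacc zrej).verif (keyState k) o.1 o.2 Verdict.acc0
          + (fingerprintScheme d S enc zacc zrej).verif (keyState k) o.1 o.2 Verdict.acc1)
      ≤ Real.exp (-(b ^ 2 / 2))
        * ∑ k, A.outputProb (fingerprintScheme d S enc zacc zrej) k m o := by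
  have hd : 0 < d := hn.trans_le (Nat.div_le_self d S)
  set Q := fingerprintScheme d S enc zacc zrej
  set u := 1 - b / √E
  set β := passBound ((d / S : ℕ) / d) (p1Param ((d / S : ℕ) / d) d T) (enc m) (enc o.1)
    with hβ_def
  have hu0 : 0 < u := sub_pos.mpr ((div_lt_one (hb.trans_lt hbE)).mpr hbE)
  have hu1 : u ≤ 1 := sub_le_self 1 (by positivity)
  have hα1 := natCast_div_div_le_one d S
  have hβ (i : Fin N) : β i ∈ Set.Icc 0 1 :=
    ⟨passBound_nonneg hα1 (p1Param_nonneg hα1) _ _ i, passBound_le_one (by positivity) hp1 _ _ i⟩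
  have hEβ : E ≤ ∑ i, (1 - β i) := by rwa [sum_one_sub_passBound, Fintype.card_fin]
  calc _ ≤ ∑ k, A.outputProb Q k m o * (Real.exp (-(Real.log u * zrej))
          * ∏ i, (passProb (enc o.1 i) (o.2 i) (k i)
            + u * (1 - passProb (enc o.1 i) (o.2 i) (k i)))) := by
        refine Finset.sum_le_sum fun k _ =>
          mul_le_mul_of_nonneg_left ?_ (A.outputProb_nonneg Q k m o)
        have haccept := verif_acc0_add_verif_acc1_le enc hd hz k o.1 o.2
          (Real.log_nonpos hu0.le hu1)
        rwa [Real.exp_log hu0] at haccept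
    _ ≤ Real.exp (-(Real.log u * zrej))
          * ((∏ i, (β i + u * (1 - β i))) * ∑ k, A.outputProb Q k m o) := by
        simp only [mul_left_comm _ (Real.exp _), ← Finset.mul_sum]
        gcongr
        exact sum_outputProb_mul_prod_passProb_le enc zacc zrej A m o hn hTL ⟨hu0.le, hu1⟩ hβ_def
    _ ≤ Real.exp (-(b ^ 2 / 2)) * ∑ k, A.outputProb Q k m o := by
        rw [← mul_assoc]
        exact mul_le_mul_of_nonneg_right (exp_neg_log_mul_prod_le hβ hb hbE hEβ hzrej)
          (Finset.sum_nonneg fun k _ => A.outputProb_nonneg Q k m o)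

theorem sum_sum_sum_outputProb (hd : 0 < d)
    (A : ForgeryAdversary (Fin N → Fin d) (Fin K → Fin S) (Fin N → Fin (d - d / S) → Bool) T V) :
    ∑ m, ∑ o, ∑ k, A.outputProb (fingerprintScheme d S enc zacc zrej) k m o
      = Fintype.card (Fin N → Fin d → Bool) := by
  calc _ = ∑ k, ∑ m, ∑ o, A.outputProb (fingerprintScheme d S enc zacc zrej) k m o :=
        (Finset.sum_congr rfl fun m _ => Finset.sum_comm).trans Finset.sum_comm
    _ = ∑ _k : Fin N → Fin d → Bool, (1 : ℝ) := Finset.sum_congr rfl fun k _ =>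
        (A.sum_outputProb _ k).trans (norm_sq_tensorCopies_keyState hd k)
    _ = Fintype.card (Fin N → Fin d → Bool) := by simp

theorem isForgerySecure_fingerprintScheme (hn : 0 < d / S)
    (hTL : T * Real.logb 2 d ≤ (d / S : ℕ)) (hp1 : p1Param ((d / S : ℕ) / d) d T ≤ 1)
    {E b ε : ℝ} (hb : 0 ≤ b) (hbE : b < √E) (hz : zacc < zrej) (hzrej : zrej ≤ E - √E * b)
    (hE : ∀ x x', x ≠ x' → E ≤ N * ((d / S : ℕ) / d) + hammingDist (enc x) (enc x')
      * (1 - p1Param ((d / S : ℕ) / d) d T - (d / S : ℕ) / d))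
    (hε : Real.exp (-(b ^ 2 / 2)) ≤ ε) :
    (fingerprintScheme d S enc zacc zrej).IsForgerySecure T ε := by
  intro V _ _ _ A
  have hd : 0 < d := hn.trans_le (Nat.div_le_self d S)
  have hcard : (0 : ℝ) < Fintype.card (Fin N → Fin d → Bool) :=
    Nat.cast_pos.mpr Fintype.card_pos
  rw [ForgeryAdversary.forgeryProb, inv_mul_le_iff₀ hcard, mul_comm,
    ← sum_sum_sum_outputProb enc (zacc := zacc) (zrej := zrej) hd A, Finset.mul_sum,
    Finset.sum_comm]
  refine Finset.sum_le_sum fun m _ => ?_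
  rw [Finset.mul_sum, Finset.sum_comm]
  refine Finset.sum_le_sum fun o _ => ?_
  have houtput : 0 ≤ ∑ k, A.outputProb (fingerprintScheme d S enc zacc zrej) k m o :=
    Finset.sum_nonneg fun k _ => A.outputProb_nonneg _ k m o
  rcases eq_or_ne o.1 m with hmo | hmo
  · simp only [hmo, ne_eq, not_true_eq_false, if_false, Finset.sum_const_zero]
    exact mul_nonneg ((Real.exp_pos _).le.trans hε) houtput
  · simp only [hmo, ne_eq, not_false_eq_true, if_true]
    exact (sum_outputProb_mul_verif_le enc A m o hn hTL hp1 hb hbE hz hzrej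
      (hE m o.1 hmo.symm)).trans (mul_le_mul_of_nonneg_right hε houtput)

end Security

section Thresholds

variable {α ν εc εf : ℝ} {d T N : ℕ}

theorem add_sqrt_mul_le_of_lengthParam_le (hα : 0 < α) (hgap : 0 < 1 - p1Param α d T - α)
    (hN : lengthParam α ν d T εc εf ≤ N) :
    √(3 * Real.log εc⁻¹) + √(1 + 4 * thetaParam α ν) * √(2 * Real.log εf⁻¹)
      ≤ (1 - p1Param α d T - α) * √(N * α) := by
  rw [mul_comm (1 - p1Param α d T - α), ← div_le_iff₀ hgap]
  refine Real.le_sqrt_of_sq_le (le_trans (le_of_eq ?_) (mul_le_mul_of_nonneg_right hN hα.le))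
  rw [lengthParam]
  field_simp

theorem zRejParam_eq : zRejParam α ν d T N εf
    = N * α * (1 + (1 + ν) * (1 - p1Param α d T - α))
      - √(N * α * (1 + (1 + ν) * (1 - p1Param α d T - α))) * √(2 * Real.log εf⁻¹) := by
  have hmean : (1 - 2 * thetaParam α ν) * N * α + 2 * thetaParam α ν * N * (1 - p1Param α d T)
      = N * α * (1 + (1 + ν) * (1 - p1Param α d T - α)) := by
    rw [thetaParam]
    ring
  rw [zRejParam, hmean]

theorem add_sqrt_mul_lt_sub_sqrt_mul {g a b M : ℝ} (hν : 0 ≤ ν) (hg : 0 < g) (hgα : g < 2 * α)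
    (ha : 0 ≤ a) (hb : 0 < b) (h : a + √(1 + 4 * thetaParam α ν) * b ≤ g * √M) :
    M + √M * a < M * (1 + (1 + ν) * g) - √(M * (1 + (1 + ν) * g)) * b := by
  have : 0 < α := by linarith
  set c := √(1 + 4 * thetaParam α ν)
  have hfactor : √(1 + (1 + ν) * g) < c :=
    Real.sqrt_lt_sqrt (by positivity) (by rw [thetaParam]; nlinarith)
  have hc0 : 0 < c := (Real.sqrt_nonneg _).trans_lt hfactor
  have hM : 0 < √M := pos_of_mul_pos_right ((by positivity : 0 < a + c * b).trans_le h) hg.le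
  have hsq : √M ^ 2 = M := Real.sq_sqrt (Real.sqrt_pos.mp hM).le
  have hsqrt : √(M * (1 + (1 + ν) * g)) * b < √M * c * b := by
    rw [Real.sqrt_mul (Real.sqrt_pos.mp hM).le]
    gcongr
  have hmul : √M * (a + c * b) ≤ M * g := by
    nlinarith [mul_le_mul_of_nonneg_left h hM.le]
  have hνg : 0 ≤ M * (ν * g) := by rw [← hsq]; positivity
  linarith

theorem exp_neg_sq_sqrt_mul_log_inv_div {c ε : ℝ} (hc : 0 < c) (hε : 0 < ε) (hε1 : ε ≤ 1) :
    Real.exp (-(√(c * Real.log ε⁻¹) ^ 2 / c)) = ε := by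
  have hlog : 0 ≤ Real.log ε⁻¹ := Real.log_nonneg ((one_le_inv₀ hε).mpr hε1)
  rw [Real.sq_sqrt (by positivity), mul_div_cancel_left₀ _ hc.ne', Real.log_inv, neg_neg,
    Real.exp_log hε]

theorem sqrt_mul_log_inv_pos {c ε : ℝ} (hc : 0 < c) (hε : 0 < ε) (hε1 : ε < 1) :
    0 < √(c * Real.log ε⁻¹) :=
  Real.sqrt_pos.mpr (mul_pos hc (Real.log_pos ((one_lt_inv₀ hε).mpr hε1)))

theorem sqrt_le_sqrt_of_lengthParam_le (hα : 0 < α) (hα1 : α ≤ 1)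
    (hgap : 0 < 1 - p1Param α d T - α) (hN : lengthParam α ν d T εc εf ≤ N) :
    √(3 * Real.log εc⁻¹) ≤ √(N * α) := by
  have hg1 : 1 - p1Param α d T - α ≤ 1 := by linarith [p1Param_nonneg (d := d) (T := T) hα1]
  calc √(3 * Real.log εc⁻¹)
      ≤ √(3 * Real.log εc⁻¹) + √(1 + 4 * thetaParam α ν) * √(2 * Real.log εf⁻¹) :=
        le_add_of_nonneg_right (by positivity)
    _ ≤ (1 - p1Param α d T - α) * √(N * α) := add_sqrt_mul_le_of_lengthParam_le hα hgap hN
    _ ≤ √(N * α) := mul_le_of_le_one_left (Real.sqrt_nonneg _) hg1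

theorem le_zAccParam : N * α ≤ zAccParam α N εc :=
  le_add_of_nonneg_right (by positivity)

theorem zAccParam_lt_zRejParam {n : ℕ} (hn : 0 < n) (h2n : 2 * n ≤ d)
    (hTL : T * Real.logb 2 d ≤ n) (hν : 0 ≤ ν) (hgap : 0 < 1 - p1Param (n / d) d T - n / d)
    (hεf : 0 < √(2 * Real.log εf⁻¹)) (hN : lengthParam (n / d) ν d T εc εf ≤ N) :
    zAccParam (n / d) N εc < zRejParam (n / d) ν d T N εf := by
  have hd : 0 < d := by lia
  rw [zRejParam_eq]
  exact add_sqrt_mul_lt_sub_sqrt_mul hν hgap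
    (by linarith [one_sub_three_mul_lt_p1Param hn h2n hTL]) (Real.sqrt_nonneg _) hεf
    (add_sqrt_mul_le_of_lengthParam_le (by positivity) hgap hN)

theorem sqrt_lt_sqrt_of_zAccParam_lt_zRejParam (hα : 0 < α) (hν : 0 ≤ ν)
    (hgap : 0 < 1 - p1Param α d T - α) (hz : zAccParam α N εc < zRejParam α ν d T N εf) :
    √(2 * Real.log εf⁻¹) < √(N * α * (1 + (1 + ν) * (1 - p1Param α d T - α))) := by
  have hE : 0 ≤ N * α * (1 + (1 + ν) * (1 - p1Param α d T - α)) := by positivity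
  have hpos := ((by positivity : 0 ≤ N * α).trans le_zAccParam).trans_lt hz
  rw [zRejParam_eq] at hpos
  nth_rewrite 1 [← Real.mul_self_sqrt hE] at hpos
  rw [← mul_sub] at hpos
  exact sub_pos.mp (pos_of_mul_pos_right hpos (Real.sqrt_nonneg _))

end Thresholds

theorem proposition2_general
    (K N S d T : ℕ) (α ν εc εf : ℝ)
    (hS : 2 ≤ S) (hd : 0 < d) (hSd : S ∣ d) (hα : α = 1 / (S : ℝ))
    (hφ : phiParam d T ≤ α)
    (hgap : 0 < 1 - p1Param α d T - α)
    (hν : 0 ≤ ν)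
    (hεc : 0 < εc) (hεc1 : εc < 1) (hεf : 0 < εf) (hεf1 : εf < 1)
    (hN : lengthParam α ν d T εc εf ≤ (N : ℝ))
    (enc : (Fin K → Fin S) → (Fin N → Fin S))
    (henc : ∀ x x' : Fin K → Fin S, x ≠ x' →
      2 * thetaParam α ν * (N : ℝ) ≤ (hammingDist (enc x) (enc x') : ℝ)) :
    α * (N : ℝ) ≤ zAccParam α N εc ∧
    zAccParam α N εc < zRejParam α ν d T N εf ∧
    (fingerprintScheme d S enc (zAccParam α N εc) (zRejParam α ν d T N εf)).IsCorrect εc ∧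
    (fingerprintScheme d S enc (zAccParam α N εc) (zRejParam α ν d T N εf)).IsForgerySecure
      T εf := by
  have hn : 0 < d / S := Nat.div_pos (Nat.le_of_dvd hd hSd) (two_pos.trans_le hS)
  have h2n : 2 * (d / S) ≤ d := (Nat.mul_le_mul_right _ hS).trans (Nat.mul_div_le d S)
  obtain rfl : α = (d / S : ℕ) / d := by
    rw [hα, Nat.cast_div hSd (by positivity)]
    field_simp
  have hTL : T * Real.logb 2 d ≤ (d / S : ℕ) :=
    (div_le_div_iff_of_pos_right (Nat.cast_pos.mpr hd)).mp hφ
  have hα0 : 0 < ((d / S : ℕ) / d : ℝ) := by positivity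
  have ha := sqrt_mul_log_inv_pos three_pos hεc hεc1
  have hb := sqrt_mul_log_inv_pos two_pos hεf hεf1
  have hz := zAccParam_lt_zRejParam hn h2n hTL hν hgap hb hN
  refine ⟨mul_comm (N : ℝ) _ ▸ le_zAccParam, hz,
    isCorrect_fingerprintScheme enc hn ha
      (sqrt_le_sqrt_of_lengthParam_le hα0 (natCast_div_div_le_one d S) hgap hN) le_rfl
      (exp_neg_sq_sqrt_mul_log_inv_div three_pos hεc hεc1.le).le,
    isForgerySecure_fingerprintScheme enc hn hTL (by linarith) hb.le
      (sqrt_lt_sqrt_of_zAccParam_lt_zRejParam hα0 hν hgap hz) hz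
      zRejParam_eq.le (fun x x' hxx' => ?_)
      (exp_neg_sq_sqrt_mul_log_inv_div two_pos hεf hεf1.le).le⟩
  have hdist := mul_le_mul_of_nonneg_right (henc x x' hxx') hgap.le
  rw [thetaParam] at hdist
  linarith

theorem proposition2
    (K N S d T : ℕ) (α ν εc εf : ℝ)
    (hS : 2 ≤ S) (hd : 0 < d) (hSd : S ∣ d) (hα : α = 1 / (S : ℝ))
    (hφ : phiParam d T ≤ α)
    (hgap : 0 < 1 - p1Param α d T - α)
    (hν : α < ν)
    (hεc : 0 < εc) (hεc1 : εc < 1) (hεf : 0 < εf) (hεf1 : εf < 1)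
    (hN : lengthParam α ν d T εc εf ≤ (N : ℝ))
    (enc : (Fin K → Fin S) → (Fin N → Fin S))
    (henc : ∀ x x' : Fin K → Fin S, x ≠ x' →
      2 * thetaParam α ν * (N : ℝ) ≤ (hammingDist (enc x) (enc x') : ℝ)) :
    α * (N : ℝ) ≤ zAccParam α N εc ∧
    zAccParam α N εc < zRejParam α ν d T N εf ∧
    (fingerprintScheme d S enc (zAccParam α N εc) (zRejParam α ν d T N εf)).IsCorrect εc ∧
    (fingerprintScheme d S enc (zAccParam α N εc) (zRejParam α ν d T N εf)).IsForgerySecure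
      T εf :=
  proposition2_general K N S d T α ν εc εf hS hd hSd hα hφ hgap
    ((hα ▸ by positivity : 0 ≤ α).trans hν.le) hεc hεc1 hεf hεf1 hN enc henc
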